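/- Let $\Omega\subset\mathbb R$ be a non-empty bounded open interval with Lebesgue measure $\lambda$. For $t>1/2$ and $f\in L^2(\Omega)$ put $$\|f\|_{t,2}^2=\sum_{0\le\alpha\le\lfloor t\rfloor}\int_\Omega |f^{(\alpha)}|^2\,d\lambda+\mathbf 1_{\{t\notin\mathbb N\}}\int_\Omega\int_\Omega\frac{|f^{(\lfloor t\rfloor)}(x)-f^{(\lfloor t\rfloor)}(y)|^2}{|x-y|^{1+2(t-\lfloor t\rfloor)}}\,d\lambda(x)\,d\lambda(y),$$ where $f^{(\alpha)}$ are weak derivatives (and $\|f\|_{t,2}=\infty$ if one of those of order at most $\lfloor t\rfloor$ does not exist). Let $\mathsf W_2^t(\Omega)$ be the space of bounded continuous $f:\Omega\to\mathbb R$ with $\|f\|_{t,2}<\infty$, and let $$\mathcal P=\mathcal P(t,\zeta,D)=\Big\{p\in\mathsf W_2^t(\Omega):\int_\Omega p\,d\lambda=1,\ \inf_{\Omega}p\ge\zeta,\ \|p\|_{t,2}\le D\Big\},$$ where $t>1/2$, $D>0$ and $0\le\zeta<\lambda(\Omega)^{-1}<D^2$. Equip $\mathcal P$ with the metric of the sup-norm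 $\|\cdot\|_\Omega$ and its Borel $\sigma$-field. Let $\log 0=-\infty$. (a) Let $n\ge1$. For all $x_1,\dots,x_n\in\Omega$ there is exactly one $\hat p_n=\hat p_n(\cdot\,;x_1,\dots,x_n)\in\mathcal P$ with $$L_n(\hat p_n)=\sup_{p\in\mathcal P}L_n(p),\qquad L_n(p)=\frac1n\sum_{i=1}^n\log p(x_i)\in[-\infty,\infty).$$ The resulting map $\hat p_n:\Omega^n\to\mathcal P$ is measurable with respect to $\mathcal B(\Omega)^n$ and $\mathcal B(\mathcal P,\|\cdot\|_\Omega)$, and $\|\hat p_n\|_{t,2}=D$ always holds. (b) Let $\Theta\subset\mathbb R^m$ be non-empty and compact, $(V,\mathcal V)$ a measurable space, and $\rho:V\times\Theta\to\Omega$ a map such that $\rho(\cdot,\theta)$ is measurable for every $\theta\in\Theta$. Let $k\ge1$. For all $\theta\in\Theta$ and $v_1,\dots,v_k\in V$ there is exactly one $\tilde p_k(\theta)=\tilde p_k(\theta)(\cdot\,;v_1,\dots,v_k)\in\mathcal P$ with $$L_k(\theta,\tilde p_k(\theta))=\sup_{p\in\mathcal P}L_k(\theta,p),\qquad L_k(\theta,p)=\frac1k\sum_{i=1}^k\log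 p(\rho(v_i,\theta))\in[-\infty,\infty).$$ For every $\theta\in\Theta$ the resulting map $\tilde p_k(\theta):V^k\to\mathcal P$ is measurable with respect to $\mathcal V^k$ and $\mathcal B(\mathcal P,\|\cdot\|_\Omega)$, and $\|\tilde p_k(\theta)\|_{t,2}=D$ always holds. If moreover $\theta\mapsto\rho(v,\theta)$ is continuous on $\Theta$ for every $v\in V$, then for every fixed $v_1,\dots,v_k\in V$ the map $\theta\mapsto\tilde p_k(\theta)$ from $\Theta$ to $(\mathcal P,\|\cdot\|_\Omega)$ is continuous. -/

import Mathlib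

open scoped ENNReal ContDiff BoundedContinuousFunction

/-- Lebesgue measure on the (measurable) subset `Ω` of the real line. -/
noncomputable abbrev lebesgueOn (Ω : Set ℝ) : MeasureTheory.Measure Ω :=
  MeasureTheory.Measure.comap (Subtype.val : Ω → ℝ) MeasureTheory.volume

/-- `g` is a weak derivative of order `k` of `f` on the open set `Ω`: both functions are locally
integrable on `Ω`, and integration by parts holds against all smooth functions with compact support
in `Ω`. -/
def HasWeakDeriv (Ω : Set ℝ) (k : ℕ) (f g : Ω → ℝ) : Prop :=
  MeasureTheory.LocallyIntegrable f (lebesgueOn Ω) ∧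
  MeasureTheory.LocallyIntegrable g (lebesgueOn Ω) ∧
  ∀ φ : ℝ → ℝ, ContDiff ℝ ∞ φ → HasCompactSupport φ → tsupport φ ⊆ Ω →
    ∫ x : Ω, f x * iteratedDeriv k φ x ∂(lebesgueOn Ω) =
      (-1 : ℝ) ^ k * ∫ x : Ω, g x * φ x ∂(lebesgueOn Ω)

open Classical in
/-- The weak derivative of order `k` of `f` on `Ω` (some version of it; versions agree almost
everywhere), and `0` if there is none. -/
noncomputable def weakDeriv (Ω : Set ℝ) (k : ℕ) (f : Ω → ℝ) : Ω → ℝ :=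
  if h : ∃ g, HasWeakDeriv Ω k f g then h.choose else 0

open Classical in
/-- The square of the Sobolev norm of order `s ≥ 0` of `f`, as an element of `[0, ∞]`. It is `∞` if
one of the weak derivatives up to the order `⌊s⌋` does not exist. For a non-integer `s` it includes
the Slobodeckij double integral of the weak derivative of order `⌊s⌋`. -/
noncomputable def sobolevENormSq (Ω : Set ℝ) (s : ℝ) (f : Ω → ℝ) : ℝ≥0∞ :=
  if ∀ k ≤ ⌊s⌋₊, ∃ g, HasWeakDeriv Ω k f g then
    (∑ k ∈ Finset.range (⌊s⌋₊ + 1),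
      ∫⁻ x : Ω, ENNReal.ofReal (weakDeriv Ω k f x ^ 2) ∂(lebesgueOn Ω)) +
      if (⌊s⌋₊ : ℝ) = s then 0
      else ∫⁻ x : Ω, ∫⁻ y : Ω, ENNReal.ofReal
        ((weakDeriv Ω ⌊s⌋₊ f x - weakDeriv Ω ⌊s⌋₊ f y) ^ 2 /
          |(x : ℝ) - (y : ℝ)| ^ (1 + 2 * (s - (⌊s⌋₊ : ℝ)))) ∂(lebesgueOn Ω) ∂(lebesgueOn Ω)
  else ⊤

/-- The Sobolev norm of order `s ≥ 0` on `Ω`, with values in `[0, ∞]`. -/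
noncomputable def sobolevENorm (Ω : Set ℝ) (s : ℝ) (f : Ω → ℝ) : ℝ≥0∞ :=
  sobolevENormSq Ω s f ^ (1 / 2 : ℝ)

/-- The square integrable functions with finite Sobolev norm of order `s`. -/
def MemSobolev (Ω : Set ℝ) (s : ℝ) (f : Ω → ℝ) : Prop :=
  MeasureTheory.MemLp f 2 (lebesgueOn Ω) ∧ sobolevENorm Ω s f < ⊤

/-- The Sobolev space of order `s` (for `s > 1/2`), consisting of bounded continuous functions
on `Ω`. -/
def sobolevSpace (Ω : Set ℝ) (s : ℝ) : Set (Ω →ᵇ ℝ) :=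
  {f | MemSobolev Ω s f}

/-- The non-parametric model of probability densities in the Sobolev ball of radius `D` and order
`t` that are bounded below by `ζ`. As a subset of the bounded continuous functions, it carries the
sup-norm metric. -/
def densityModel (Ω : Set ℝ) (t ζ D : ℝ) : Set (Ω →ᵇ ℝ) :=
  {p | p ∈ sobolevSpace Ω t ∧ ∫ x : Ω, p x ∂(lebesgueOn Ω) = 1 ∧ (∀ x, ζ ≤ p x) ∧
    sobolevENorm Ω t p ≤ ENNReal.ofReal D}

/-- The normalized log-likelihood `n⁻¹ ∑ log p(x i)` of a non-negative function `p` at the data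
`x`, with values in the extended reals and `log 0 = -∞`. -/
noncomputable def logLik {Ω : Set ℝ} {n : ℕ} (p : Ω → ℝ) (x : Fin n → Ω) : EReal :=
  ((1 / (n : ℝ) : ℝ) : EReal) * ∑ i, ENNReal.log (ENNReal.ofReal (p (x i)))

/-- The normalized log-likelihood `k⁻¹ ∑ log p(ρ(v i, θ))` at the simulated data. -/
noncomputable def simLogLik {Ω : Set ℝ} {V T : Type*} {k : ℕ} (ρ : V → T → Ω) (θ : T)
    (p : Ω → ℝ) (v : Fin k → V) : EReal :=
  ((1 / (k : ℝ) : ℝ) : EReal) * ∑ i, ENNReal.log (ENNReal.ofReal (p (ρ (v i) θ)))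

/-!
The model `densityModel` is convex, and it is compact in the sup-norm. Indeed, the Sobolev ball is
bounded and uniformly equicontinuous, because a finite Sobolev norm of order `t > 1/2` controls a
modulus of continuity, and it is closed, because the parallelogram identity and completeness of
`L²` make the norm lower semicontinuous. So the likelihood attains its maximum. If a maximizer had
norm less than `D`, then mixing in a small multiple of a smooth density that is very large at the
data would increase the likelihood. The midpoint of two maximizers is a maximizer by the
inequality of arithmetic and geometric means; all three have norm `D`, and the parallelogram
identity forces the two to coincide. Finally, a unique maximizer over a compact set depends
continuously on the data.
-/

open MeasureTheory Filter Topology Set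

/-! ### Lebesgue measure on a subset -/

section LebesgueOn

variable {Ω : Set ℝ}

theorem lebesgueOn_univ (hΩ : MeasurableSet Ω) : lebesgueOn Ω univ = volume Ω := by
  rw [comap_subtype_coe_apply hΩ, image_univ, Subtype.range_coe]

instance isFiniteMeasure_lebesgueOn_Ioo (a b : ℝ) : IsFiniteMeasure (lebesgueOn (Ioo a b)) :=
  ⟨by rw [lebesgueOn_univ measurableSet_Ioo]; simp⟩

instance isOpenPosMeasure_lebesgueOn_Ioo (a b : ℝ) : (lebesgueOn (Ioo a b)).IsOpenPosMeasure :=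
  Measure.IsOpenPosMeasure.comap volume isOpen_Ioo.isOpenEmbedding_subtypeVal

theorem measureReal_lebesgueOn_Ioo_univ {a b : ℝ} (hab : a ≤ b) :
    (lebesgueOn (Ioo a b)).real univ = b - a := by
  rw [measureReal_def, lebesgueOn_univ measurableSet_Ioo, Real.volume_Ioo,
    ENNReal.toReal_ofReal (sub_nonneg.2 hab)]

theorem locallyIntegrable_lebesgueOn_of_continuous (hΩ : MeasurableSet Ω) {u : ℝ → ℝ}
    (hu : Continuous u) : LocallyIntegrable (fun x : Ω => u x) (lebesgueOn Ω) :=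
  (locallyIntegrable_comap hΩ).2 (hu.locallyIntegrable.locallyIntegrableOn Ω)

end LebesgueOn

/-! ### Test functions and weak derivatives -/

/-- `φ` is a test function on `Ω`, that is, one of the functions that `HasWeakDeriv` integrates
against. -/
structure IsTestFunction (Ω : Set ℝ) (φ : ℝ → ℝ) : Prop where
  contDiff : ContDiff ℝ ∞ φ
  hasCompactSupport : HasCompactSupport φ
  tsupport_subset : tsupport φ ⊆ Ω

namespace IsTestFunction

variable {Ω : Set ℝ} {φ ψ : ℝ → ℝ}

theorem continuous (hφ : IsTestFunction Ω φ) : Continuous φ :=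
  hφ.contDiff.continuous

theorem eq_zero_of_notMem (hφ : IsTestFunction Ω φ) {x : ℝ} (hx : x ∉ Ω) : φ x = 0 :=
  image_eq_zero_of_notMem_tsupport fun h => hx (hφ.tsupport_subset h)

theorem deriv (hφ : IsTestFunction Ω φ) : IsTestFunction Ω (deriv φ) where
  contDiff := (contDiff_infty_iff_deriv.1 hφ.contDiff).2
  hasCompactSupport := hφ.hasCompactSupport.deriv
  tsupport_subset := tsupport_deriv_subset.trans hφ.tsupport_subset

theorem iteratedDeriv (hφ : IsTestFunction Ω φ) (k : ℕ) :
    IsTestFunction Ω (iteratedDeriv k φ) := by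
  induction k with
  | zero => simpa only [iteratedDeriv_zero] using hφ
  | succ k ih => simpa only [iteratedDeriv_succ] using ih.deriv

theorem sub (hφ : IsTestFunction Ω φ) (hψ : IsTestFunction Ω ψ) : IsTestFunction Ω (φ - ψ) where
  contDiff := hφ.contDiff.sub hψ.contDiff
  hasCompactSupport := hφ.hasCompactSupport.sub hψ.hasCompactSupport
  tsupport_subset :=
    (tsupport_sub φ ψ).trans (union_subset hφ.tsupport_subset hψ.tsupport_subset)

theorem const_smul (hφ : IsTestFunction Ω φ) (c : ℝ) : IsTestFunction Ω (c • φ) where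
  contDiff := hφ.contDiff.const_smul c
  hasCompactSupport := hφ.hasCompactSupport.smul_left (f := fun _ => c)
  tsupport_subset := (tsupport_smul_subset_right (fun _ => c) φ).trans hφ.tsupport_subset

theorem integrable (hφ : IsTestFunction Ω φ) : Integrable φ :=
  hφ.continuous.integrable_of_hasCompactSupport hφ.hasCompactSupport

theorem integrable_mul (hφ : IsTestFunction Ω φ) {f : Ω → ℝ}
    (hf : LocallyIntegrable f (lebesgueOn Ω)) :
    Integrable (fun x : Ω => f x * φ x) (lebesgueOn Ω) := by
  have hK : IsCompact ((↑) ⁻¹' tsupport φ : Set Ω) :=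
    IsInducing.subtypeVal.isCompact_preimage' hφ.hasCompactSupport
      (by simpa using hφ.tsupport_subset)
  have hsupp : HasCompactSupport fun x : Ω => φ x :=
    HasCompactSupport.intro hK fun x hx => image_eq_zero_of_notMem_tsupport hx
  have hint := hf.integrable_smul_left_of_hasCompactSupport
    (hφ.continuous.comp continuous_subtype_val) hsupp
  simpa [mul_comm] using hint

theorem integral_lebesgueOn_mul (hφ : IsTestFunction Ω φ) (hΩ : MeasurableSet Ω) (u : ℝ → ℝ) :
    ∫ x : Ω, u x * φ x ∂(lebesgueOn Ω) = ∫ x, u x * φ x := by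
  rw [integral_subtype_comap hΩ fun x => u x * φ x]
  exact setIntegral_eq_integral_of_forall_compl_eq_zero fun x hx => by
    rw [hφ.eq_zero_of_notMem hx, mul_zero]

theorem integral_mul_iteratedDeriv (hφ : IsTestFunction Ω φ) {u : ℝ → ℝ} (hu : ContDiff ℝ ∞ u)
    (k : ℕ) : ∫ x, u x * _root_.iteratedDeriv k φ x =
      (-1) ^ k * ∫ x, _root_.iteratedDeriv k u x * φ x := by
  induction k generalizing u with
  | zero => simp
  | succ k ih =>
    obtain ⟨hud, hu'⟩ := contDiff_infty_iff_deriv.1 hu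
    have hφk := hφ.iteratedDeriv k
    have hparts := integral_mul_deriv_eq_deriv_mul_of_integrable
      (fun x _ => (hud x).hasDerivAt)
      (fun x _ => (hφk.contDiff.differentiable (by simp) x).hasDerivAt)
      ((hu.continuous.mul hφk.deriv.continuous).integrable_of_hasCompactSupport
        hφk.deriv.hasCompactSupport.mul_left)
      ((hu'.continuous.mul hφk.continuous).integrable_of_hasCompactSupport
        hφk.hasCompactSupport.mul_left)
      ((hu.continuous.mul hφk.continuous).integrable_of_hasCompactSupport
        hφk.hasCompactSupport.mul_left)
    rw [iteratedDeriv_succ, hparts, ih hu', iteratedDeriv_succ']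
    ring

end IsTestFunction

theorem ae_eq_zero_of_forall_integral_mul_testFunction {Ω : Set ℝ} (hΩ : IsOpen Ω) {f : Ω → ℝ}
    (hf : LocallyIntegrable f (lebesgueOn Ω))
    (h : ∀ φ, IsTestFunction Ω φ → ∫ x : Ω, f x * φ x ∂(lebesgueOn Ω) = 0) :
    f =ᵐ[lebesgueOn Ω] 0 := by
  set F : ℝ → ℝ := Function.extend (↑) f 0
  have hF : ∀ x : Ω, F x = f x := fun x => Subtype.val_injective.extend_apply f 0 x
  have hFloc : LocallyIntegrableOn F Ω volume := by
    simpa only [← locallyIntegrable_comap hΩ.measurableSet, hF] using hf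
  have hF0 : ∀ᵐ x, x ∈ Ω → F x = 0 := by
    refine hΩ.ae_eq_zero_of_integral_contDiff_smul_eq_zero hFloc fun φ hφ hc hs => ?_
    have hφ : IsTestFunction Ω φ := ⟨hφ, hc, hs⟩
    simpa only [smul_eq_mul, mul_comm, hF] using
      (hφ.integral_lebesgueOn_mul hΩ.measurableSet F).symm.trans (by simpa only [hF] using h φ hφ)
  rw [← ae_restrict_iff' hΩ.measurableSet, ← map_comap_subtype_coe hΩ.measurableSet] at hF0
  filter_upwards [ae_of_ae_map measurable_subtype_coe.aemeasurable hF0] with x hx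
  rwa [hF] at hx

theorem hasWeakDeriv_zero {Ω : Set ℝ} {f : Ω → ℝ} (hf : LocallyIntegrable f (lebesgueOn Ω)) :
    HasWeakDeriv Ω 0 f f :=
  ⟨hf, hf, fun φ _ _ _ => by simp⟩

theorem hasWeakDeriv_of_contDiff {Ω : Set ℝ} (hΩ : MeasurableSet Ω) {u : ℝ → ℝ}
    (hu : ContDiff ℝ ∞ u) (k : ℕ) :
    HasWeakDeriv Ω k (fun x => u x) (fun x => iteratedDeriv k u x) := by
  refine ⟨locallyIntegrable_lebesgueOn_of_continuous hΩ hu.continuous,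
    locallyIntegrable_lebesgueOn_of_continuous hΩ
      (hu.continuous_iteratedDeriv k (mod_cast le_top)), fun φ hφ hc hs => ?_⟩
  have hφ : IsTestFunction Ω φ := ⟨hφ, hc, hs⟩
  rw [(hφ.iteratedDeriv k).integral_lebesgueOn_mul hΩ, hφ.integral_lebesgueOn_mul hΩ,
    hφ.integral_mul_iteratedDeriv hu]

namespace HasWeakDeriv

variable {Ω : Set ℝ} {k : ℕ} {f f₁ f₂ g g' g₁ g₂ : Ω → ℝ}

theorem aemeasurable (h : HasWeakDeriv Ω k f g) : AEMeasurable g (lebesgueOn Ω) :=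
  h.2.1.aestronglyMeasurable.aemeasurable

theorem integral_mul_iteratedDeriv (h : HasWeakDeriv Ω k f g) {φ : ℝ → ℝ}
    (hφ : IsTestFunction Ω φ) : ∫ x : Ω, f x * iteratedDeriv k φ x ∂(lebesgueOn Ω) =
      (-1) ^ k * ∫ x : Ω, g x * φ x ∂(lebesgueOn Ω) :=
  h.2.2 φ hφ.contDiff hφ.hasCompactSupport hφ.tsupport_subset

theorem add (h₁ : HasWeakDeriv Ω k f₁ g₁) (h₂ : HasWeakDeriv Ω k f₂ g₂) :
    HasWeakDeriv Ω k (f₁ + f₂) (g₁ + g₂) := by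
  refine ⟨h₁.1.add h₂.1, h₁.2.1.add h₂.2.1, fun φ hφ hc hs => ?_⟩
  have hφ : IsTestFunction Ω φ := ⟨hφ, hc, hs⟩
  have hφk := hφ.iteratedDeriv k
  simp only [Pi.add_apply, add_mul]
  rw [integral_add (hφk.integrable_mul h₁.1) (hφk.integrable_mul h₂.1),
    integral_add (hφ.integrable_mul h₁.2.1) (hφ.integrable_mul h₂.2.1),
    h₁.integral_mul_iteratedDeriv hφ, h₂.integral_mul_iteratedDeriv hφ, mul_add]

theorem const_smul (h : HasWeakDeriv Ω k f g) (c : ℝ) : HasWeakDeriv Ω k (c • f) (c • g) := by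
  refine ⟨h.1.smul c, h.2.1.smul c, fun φ hφ hc hs => ?_⟩
  simp only [Pi.smul_apply, smul_eq_mul, mul_assoc, integral_const_mul]
  rw [h.integral_mul_iteratedDeriv ⟨hφ, hc, hs⟩]
  ring

theorem sub (h₁ : HasWeakDeriv Ω k f₁ g₁) (h₂ : HasWeakDeriv Ω k f₂ g₂) :
    HasWeakDeriv Ω k (f₁ - f₂) (g₁ - g₂) := by
  simpa only [neg_smul, one_smul, ← sub_eq_add_neg] using h₁.add (h₂.const_smul (-1))

theorem ae_eq (hΩ : IsOpen Ω) (h : HasWeakDeriv Ω k f g) (h' : HasWeakDeriv Ω k f g') :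
    g =ᵐ[lebesgueOn Ω] g' := by
  have hsub := h.sub h'
  have hzero : g - g' =ᵐ[lebesgueOn Ω] 0 := by
    refine ae_eq_zero_of_forall_integral_mul_testFunction hΩ hsub.2.1 fun φ hφ => ?_
    simpa using (hsub.integral_mul_iteratedDeriv hφ).symm
  filter_upwards [hzero] with x hx using sub_eq_zero.1 hx

theorem hasWeakDeriv_weakDeriv (h : HasWeakDeriv Ω k f g) :
    HasWeakDeriv Ω k f (weakDeriv Ω k f) := by
  have hex : ∃ g, HasWeakDeriv Ω k f g := ⟨g, h⟩
  rw [weakDeriv, dif_pos hex]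
  exact hex.choose_spec

theorem weakDeriv_ae_eq (hΩ : IsOpen Ω) (h : HasWeakDeriv Ω k f g) :
    weakDeriv Ω k f =ᵐ[lebesgueOn Ω] g :=
  h.hasWeakDeriv_weakDeriv.ae_eq hΩ h

end HasWeakDeriv

/-! ### The Sobolev quadratic form -/

section SobolevForm

variable {Ω : Set ℝ} {σ s : ℝ}

theorem lintegral_sq_div_smul_add_smul {X : Type*} [MeasurableSpace X] {μ : Measure X}
    {u v w : X → ℝ} (hu : AEMeasurable u μ) (hv : AEMeasurable v μ) (hw : AEMeasurable w μ)
    (hw0 : ∀ x, 0 ≤ w x) {c d : ℝ} (hc : 0 ≤ c) (hd : 0 ≤ d) (hcd : c + d = 1) :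
    ∫⁻ x, ENNReal.ofReal ((c * u x + d * v x) ^ 2 / w x) ∂μ +
      ENNReal.ofReal (c * d) * ∫⁻ x, ENNReal.ofReal ((u x - v x) ^ 2 / w x) ∂μ =
    ENNReal.ofReal c * ∫⁻ x, ENNReal.ofReal (u x ^ 2 / w x) ∂μ +
      ENNReal.ofReal d * ∫⁻ x, ENNReal.ofReal (v x ^ 2 / w x) ∂μ := by
  have hcomb : AEMeasurable (fun x => ENNReal.ofReal ((c * u x + d * v x) ^ 2 / w x)) μ := by
    fun_prop
  have hcu : AEMeasurable (fun x => ENNReal.ofReal c * ENNReal.ofReal (u x ^ 2 / w x)) μ := by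
    fun_prop
  simp_rw [← lintegral_const_mul' _ _ ENNReal.ofReal_ne_top]
  rw [← lintegral_add_left' hcomb, ← lintegral_add_left' hcu]
  refine lintegral_congr fun x => ?_
  have := hw0 x
  rw [← ENNReal.ofReal_mul (by positivity), ← ENNReal.ofReal_mul hc, ← ENNReal.ofReal_mul hd,
    ← ENNReal.ofReal_add (by positivity) (by positivity),
    ← ENNReal.ofReal_add (by positivity) (by positivity)]
  obtain rfl : d = 1 - c := by linarith
  ring_nf

theorem aemeasurable_increment {X : Type*} [MeasurableSpace X] {μ : Measure X} {g : X → ℝ}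
    (hg : AEMeasurable g μ) : AEMeasurable (fun z : X × X => g z.1 - g z.2) (μ.prod μ) :=
  (hg.comp_quasiMeasurePreserving Measure.quasiMeasurePreserving_fst).sub
    (hg.comp_quasiMeasurePreserving Measure.quasiMeasurePreserving_snd)

/-- The Slobodeckij double integral of `g` with fractional exponent `σ`, taken over `Ω × Ω`. -/
noncomputable def slobodeckijEnergy (Ω : Set ℝ) (σ : ℝ) (g : Ω → ℝ) : ℝ≥0∞ :=
  ∫⁻ z : Ω × Ω, ENNReal.ofReal ((g z.1 - g z.2) ^ 2 / |(z.1 : ℝ) - z.2| ^ (1 + 2 * σ))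
    ∂((lebesgueOn Ω).prod (lebesgueOn Ω))

/-- The squared Sobolev norm as a quadratic form in the family of weak derivatives, so that it can
be handled for arbitrary versions `g k` of the weak derivatives of order `k ≤ ⌊s⌋`. -/
noncomputable def sobolevForm (Ω : Set ℝ) (s : ℝ) (g : ℕ → Ω → ℝ) : ℝ≥0∞ :=
  (∑ k ∈ Finset.range (⌊s⌋₊ + 1), ∫⁻ x : Ω, ENNReal.ofReal (g k x ^ 2) ∂(lebesgueOn Ω)) +
    if (⌊s⌋₊ : ℝ) = s then 0 else slobodeckijEnergy Ω (s - ⌊s⌋₊) (g ⌊s⌋₊)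

theorem slobodeckijEnergy_congr_ae {g h : Ω → ℝ} (hgh : g =ᵐ[lebesgueOn Ω] h) :
    slobodeckijEnergy Ω σ g = slobodeckijEnergy Ω σ h := by
  refine lintegral_congr_ae ?_
  filter_upwards [Measure.quasiMeasurePreserving_fst.ae_eq_comp hgh,
    Measure.quasiMeasurePreserving_snd.ae_eq_comp hgh] with z hz₁ hz₂
  simp only [Function.comp_apply] at hz₁ hz₂
  rw [hz₁, hz₂]

theorem sobolevForm_congr_ae {g h : ℕ → Ω → ℝ} (hgh : ∀ k ≤ ⌊s⌋₊, g k =ᵐ[lebesgueOn Ω] h k) :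
    sobolevForm Ω s g = sobolevForm Ω s h := by
  rw [sobolevForm, sobolevForm, slobodeckijEnergy_congr_ae (hgh _ le_rfl)]
  congr 1
  refine Finset.sum_congr rfl fun k hk => lintegral_congr_ae ?_
  filter_upwards [hgh k (Finset.mem_range_succ_iff.1 hk)] with x hx
  rw [hx]

theorem slobodeckijEnergy_smul_add_smul {g h : Ω → ℝ} (hg : AEMeasurable g (lebesgueOn Ω))
    (hh : AEMeasurable h (lebesgueOn Ω)) {c d : ℝ} (hc : 0 ≤ c) (hd : 0 ≤ d) (hcd : c + d = 1) :
    slobodeckijEnergy Ω σ (c • g + d • h) +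
      ENNReal.ofReal (c * d) * slobodeckijEnergy Ω σ (g - h) =
    ENNReal.ofReal c * slobodeckijEnergy Ω σ g + ENNReal.ofReal d * slobodeckijEnergy Ω σ h := by
  rw [slobodeckijEnergy, slobodeckijEnergy, slobodeckijEnergy, slobodeckijEnergy,
    ← lintegral_sq_div_smul_add_smul (aemeasurable_increment hg) (aemeasurable_increment hh)
      (Measurable.aemeasurable (by fun_prop)) (fun z => by positivity) hc hd hcd]
  simp only [Pi.add_apply, Pi.smul_apply, Pi.sub_apply, smul_eq_mul, mul_sub,
    add_sub_add_comm, sub_sub_sub_comm]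

theorem sobolevForm_smul_add_smul {g h : ℕ → Ω → ℝ}
    (hg : ∀ k ≤ ⌊s⌋₊, AEMeasurable (g k) (lebesgueOn Ω))
    (hh : ∀ k ≤ ⌊s⌋₊, AEMeasurable (h k) (lebesgueOn Ω))
    {c d : ℝ} (hc : 0 ≤ c) (hd : 0 ≤ d) (hcd : c + d = 1) :
    sobolevForm Ω s (fun k => c • g k + d • h k) +
      ENNReal.ofReal (c * d) * sobolevForm Ω s (fun k => g k - h k) =
    ENNReal.ofReal c * sobolevForm Ω s g + ENNReal.ofReal d * sobolevForm Ω s h := by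
  have hsum := Finset.sum_congr (rfl : Finset.range (⌊s⌋₊ + 1) = _) fun k hk =>
    lintegral_sq_div_smul_add_smul (w := fun _ => 1) (hg k (Finset.mem_range_succ_iff.1 hk))
      (hh k (Finset.mem_range_succ_iff.1 hk)) aemeasurable_const (fun _ => zero_le_one) hc hd hcd
  simp only [div_one, Finset.sum_add_distrib, ← Finset.mul_sum] at hsum
  have hslob := slobodeckijEnergy_smul_add_smul (σ := s - ⌊s⌋₊) (hg _ le_rfl) (hh _ le_rfl)
    hc hd hcd
  simp only [sobolevForm, mul_add, Pi.add_apply, Pi.smul_apply, Pi.sub_apply, smul_eq_mul]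
  split_ifs
  · simpa only [mul_zero, add_zero] using hsum
  · rw [add_add_add_comm, hsum, hslob, add_add_add_comm]

theorem lintegral_sq_le_sobolevForm (g : ℕ → Ω → ℝ) {k : ℕ} (hk : k ≤ ⌊s⌋₊) :
    ∫⁻ x : Ω, ENNReal.ofReal (g k x ^ 2) ∂(lebesgueOn Ω) ≤ sobolevForm Ω s g :=
  (Finset.single_le_sum (f := fun k => ∫⁻ x : Ω, ENNReal.ofReal (g k x ^ 2) ∂(lebesgueOn Ω))
    (fun _ _ => zero_le) (Finset.mem_range_succ_iff.2 hk)).trans le_self_add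

theorem slobodeckijEnergy_le_sobolevForm (g : ℕ → Ω → ℝ) (hs : (⌊s⌋₊ : ℝ) ≠ s) :
    slobodeckijEnergy Ω (s - ⌊s⌋₊) (g ⌊s⌋₊) ≤ sobolevForm Ω s g := by
  rw [sobolevForm, if_neg hs]
  exact le_add_self

end SobolevForm

/-! ### The Sobolev norm -/

section SobolevNorm

variable {Ω : Set ℝ} {s : ℝ} {f h : Ω → ℝ}

theorem sobolevENormSq_eq_sobolevForm [SFinite (lebesgueOn Ω)] (hΩ : IsOpen Ω)
    {g : ℕ → Ω → ℝ} (hg : ∀ k ≤ ⌊s⌋₊, HasWeakDeriv Ω k f (g k)) :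
    sobolevENormSq Ω s f = sobolevForm Ω s g := by
  have htop := (hg _ le_rfl).hasWeakDeriv_weakDeriv.aemeasurable
  rw [sobolevENormSq, if_pos fun k hk => ⟨_, hg k hk⟩,
    ← sobolevForm_congr_ae fun k hk => (hg k hk).weakDeriv_ae_eq hΩ, sobolevForm,
    slobodeckijEnergy, lintegral_prod]
  exact (((aemeasurable_increment htop).pow_const 2).div
    (Measurable.aemeasurable (by fun_prop))).ennreal_ofReal

theorem hasWeakDeriv_weakDeriv_of_sobolevENormSq_ne_top (hf : sobolevENormSq Ω s f ≠ ⊤) :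
    ∀ k ≤ ⌊s⌋₊, HasWeakDeriv Ω k f (weakDeriv Ω k f) := by
  by_cases hex : ∀ k ≤ ⌊s⌋₊, ∃ g, HasWeakDeriv Ω k f g
  · exact fun k hk => (hex k hk).choose_spec.hasWeakDeriv_weakDeriv
  · rw [sobolevENormSq, if_neg hex] at hf
    exact absurd rfl hf

theorem sobolevENormSq_smul_add_smul [SFinite (lebesgueOn Ω)] (hΩ : IsOpen Ω)
    (hf : sobolevENormSq Ω s f ≠ ⊤) (hh : sobolevENormSq Ω s h ≠ ⊤)
    {c d : ℝ} (hc : 0 ≤ c) (hd : 0 ≤ d) (hcd : c + d = 1) :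
    sobolevENormSq Ω s (c • f + d • h) +
      ENNReal.ofReal (c * d) * sobolevENormSq Ω s (f - h) =
    ENNReal.ofReal c * sobolevENormSq Ω s f + ENNReal.ofReal d * sobolevENormSq Ω s h := by
  have hwf := hasWeakDeriv_weakDeriv_of_sobolevENormSq_ne_top hf
  have hwh := hasWeakDeriv_weakDeriv_of_sobolevENormSq_ne_top hh
  rw [sobolevENormSq_eq_sobolevForm hΩ hwf, sobolevENormSq_eq_sobolevForm hΩ hwh,
    sobolevENormSq_eq_sobolevForm hΩ fun k hk => (hwf k hk).sub (hwh k hk),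
    sobolevENormSq_eq_sobolevForm hΩ fun k hk =>
      ((hwf k hk).const_smul c).add ((hwh k hk).const_smul d)]
  exact sobolevForm_smul_add_smul (fun k hk => (hwf k hk).aemeasurable)
    (fun k hk => (hwh k hk).aemeasurable) hc hd hcd

theorem sobolevENorm_le_ofReal_iff {D : ℝ} (hD : 0 ≤ D) :
    sobolevENorm Ω s f ≤ ENNReal.ofReal D ↔ sobolevENormSq Ω s f ≤ ENNReal.ofReal (D ^ 2) := by
  rw [sobolevENorm, one_div, ENNReal.rpow_inv_le_iff two_pos,
    ENNReal.ofReal_rpow_of_nonneg hD two_pos.le, Real.rpow_two]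

end SobolevNorm

/-! ### Smooth functions have finite Sobolev norm -/

section SmoothFunctions

variable {a b : ℝ}

theorem intervalIntegrable_abs_rpow {c : ℝ} (hc : -1 < c) (u v : ℝ) :
    IntervalIntegrable (fun x : ℝ => |x| ^ c) volume u v := by
  refine intervalIntegrable_of_even (fun x => by rw [abs_neg]) fun x hx => ?_
  refine (intervalIntegral.intervalIntegrable_rpow' hc).congr fun y hy => ?_
  rw [uIoc_of_le hx.le] at hy
  simp only [abs_of_pos hy.1]

theorem lintegral_abs_sub_rpow_lt_top (a b : ℝ) {c : ℝ} (hc : -1 < c) :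
    ∫⁻ z : Ioo a b × Ioo a b, ENNReal.ofReal (|(z.1 : ℝ) - z.2| ^ c)
      ∂((lebesgueOn (Ioo a b)).prod (lebesgueOn (Ioo a b))) < ⊤ := by
  set r := b - a
  set K := ∫⁻ u in Ioc (-r) r, ENNReal.ofReal (|u| ^ c)
  have hK : K < ⊤ := (intervalIntegrable_abs_rpow hc (-r) r).1.lintegral_lt_top
  have hslice (x : Ioo a b) :
      ∫⁻ y : Ioo a b, ENNReal.ofReal (|(x : ℝ) - y| ^ c) ∂(lebesgueOn (Ioo a b)) ≤ K := by
    rw [lintegral_subtype_comap measurableSet_Ioo fun y : ℝ => ENNReal.ofReal (|(x : ℝ) - y| ^ c),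
      ← lintegral_indicator measurableSet_Ioo]
    simp only [K]
    rw [← lintegral_indicator measurableSet_Ioc,
      ← lintegral_sub_left_eq_self ((Ioc (-r) r).indicator _) (x : ℝ)]
    refine lintegral_mono fun y => ?_
    by_cases hy : y ∈ Ioo a b
    · have hxy : (x : ℝ) - y ∈ Ioc (-r) r := by
        constructor <;> linarith [hy.1, hy.2, x.2.1, x.2.2]
      rw [indicator_of_mem hy, indicator_of_mem hxy]
    · rw [indicator_of_notMem hy]
      exact zero_le
  rw [lintegral_prod _ (Measurable.aemeasurable (by fun_prop))]
  refine (lintegral_mono hslice).trans_lt ?_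
  rw [lintegral_const]
  exact ENNReal.mul_lt_top hK (measure_lt_top _ _)

theorem slobodeckijEnergy_lt_top_of_lipschitzWith {σ : ℝ} (hσ : σ < 1) {g : Ioo a b → ℝ}
    {L : NNReal} (hg : LipschitzWith L g) : slobodeckijEnergy (Ioo a b) σ g < ⊤ := by
  have hle : slobodeckijEnergy (Ioo a b) σ g ≤
      ∫⁻ z : Ioo a b × Ioo a b,
        ENNReal.ofReal (L ^ 2) * ENNReal.ofReal (|(z.1 : ℝ) - z.2| ^ (1 - 2 * σ))
        ∂((lebesgueOn (Ioo a b)).prod (lebesgueOn (Ioo a b))) := by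
    refine lintegral_mono fun z => ?_
    rw [← ENNReal.ofReal_mul (by positivity)]
    refine ENNReal.ofReal_le_ofReal (div_le_of_le_mul₀ (by positivity) (by positivity) ?_)
    rcases eq_or_ne z.1 z.2 with heq | hne
    · rw [heq, sub_self, zero_pow two_ne_zero]
      positivity
    · have hpos : 0 < |(z.1 : ℝ) - z.2| := abs_pos.2 (sub_ne_zero.2 (Subtype.coe_ne_coe.2 hne))
      have hlip : |g z.1 - g z.2| ≤ L * |(z.1 : ℝ) - z.2| := hg.dist_le_mul z.1 z.2
      rw [mul_assoc, ← Real.rpow_add hpos, sub_add_add_cancel, one_add_one_eq_two,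
        Real.rpow_two, ← mul_pow, ← sq_abs (g z.1 - g z.2)]
      gcongr
  refine hle.trans_lt ?_
  rw [lintegral_const_mul' _ _ ENNReal.ofReal_ne_top]
  exact ENNReal.mul_lt_top ENNReal.ofReal_lt_top
    (lintegral_abs_sub_rpow_lt_top a b (by linarith))

theorem lintegral_sq_lt_top_of_continuous {u : ℝ → ℝ} (hu : Continuous u) :
    ∫⁻ x : Ioo a b, ENNReal.ofReal (u x ^ 2) ∂(lebesgueOn (Ioo a b)) < ⊤ := by
  rw [lintegral_subtype_comap measurableSet_Ioo fun x => ENNReal.ofReal (u x ^ 2)]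
  exact (lintegral_mono_set Ioo_subset_Icc_self).trans_lt
    (setLIntegral_lt_top_of_isCompact isCompact_Icc.measure_ne_top isCompact_Icc
      (continuous_real_toNNReal.comp (hu.pow 2)))

theorem sobolevENormSq_lt_top_of_contDiff {s : ℝ} {u : ℝ → ℝ} (hu : ContDiff ℝ ∞ u) :
    sobolevENormSq (Ioo a b) s (fun x => u x) < ⊤ := by
  have hcont (k : ℕ) : ContDiff ℝ ∞ (iteratedDeriv k u) := by
    rw [iteratedDeriv_eq_iterate]
    exact hu.iterate_deriv k
  rw [sobolevENormSq_eq_sobolevForm isOpen_Ioo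
    fun k _ => hasWeakDeriv_of_contDiff measurableSet_Ioo hu k]
  refine ENNReal.add_lt_top.2 ⟨ENNReal.sum_lt_top.2 fun k _ =>
    lintegral_sq_lt_top_of_continuous (hcont k).continuous, ?_⟩
  split_ifs
  · exact ENNReal.zero_lt_top
  · obtain ⟨L, hL⟩ := (hcont ⌊s⌋₊).contDiffOn.exists_lipschitzOnWith (by simp)
      (convex_Icc a b) isCompact_Icc
    exact slobodeckijEnergy_lt_top_of_lipschitzWith (by linarith [Nat.lt_floor_add_one s])
      (lipschitzOnWith_iff_restrict.1 (hL.mono Ioo_subset_Icc_self))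

theorem sobolevENormSq_const (a b s c : ℝ) :
    sobolevENormSq (Ioo a b) s (fun _ => c) = ENNReal.ofReal (c ^ 2 * (b - a)) := by
  rw [sobolevENormSq_eq_sobolevForm isOpen_Ioo
    fun k _ => hasWeakDeriv_of_contDiff (u := fun _ => c) measurableSet_Ioo contDiff_const k,
    sobolevForm, Finset.sum_range_succ']
  simp [iteratedDeriv_const, slobodeckijEnergy, lebesgueOn_univ, ENNReal.ofReal_mul, sq_nonneg]

end SmoothFunctions

/-! ### Hölder continuity of functions with finite Slobodeckij energy -/

section Averages

variable {X : Type*} [MeasurableSpace X] {μ ν : Measure X} {f : X → ℝ}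

theorem ofReal_sq_integral_le [IsFiniteMeasure μ] (hf : MemLp f 2 μ) :
    ENNReal.ofReal ((∫ x, f x ∂μ) ^ 2) ≤ μ univ * ∫⁻ x, ENNReal.ofReal (f x ^ 2) ∂μ := by
  rcases eq_zero_or_neZero μ with rfl | _
  · simp
  have hsq : Integrable (fun x => f x ^ 2) μ := hf.integrable_sq
  have hjensen : (⨍ x, f x ∂μ) ^ 2 ≤ ⨍ x, f x ^ 2 ∂μ :=
    even_two.convexOn_pow.map_average_le (continuous_pow 2).continuousOn isClosed_univ
      (Eventually.of_forall fun x => mem_univ _) (hf.integrable one_le_two) hsq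
  have hμ : 0 < μ.real univ := measureReal_univ_pos
  simp only [average_eq, smul_eq_mul, ← div_eq_inv_mul, div_pow] at hjensen
  rw [div_le_div_iff₀ (by positivity) hμ] at hjensen
  rw [← ofReal_integral_eq_lintegral_ofReal hsq (ae_of_all _ fun x => sq_nonneg _),
    ← ofReal_measureReal, ← ENNReal.ofReal_mul hμ.le]
  refine ENNReal.ofReal_le_ofReal (le_of_mul_le_mul_right ?_ hμ)
  linarith

theorem average_sub_average_eq [IsFiniteMeasure μ] [IsFiniteMeasure ν] [NeZero μ] [NeZero ν]
    (hfμ : Integrable f μ) (hfν : Integrable f ν) :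
    ⨍ x, f x ∂μ - ⨍ x, f x ∂ν =
      (∫ z, (f z.1 - f z.2) ∂(μ.prod ν)) / (μ.real univ * ν.real univ) := by
  have hμ : 0 < μ.real univ := measureReal_univ_pos
  have hν : 0 < ν.real univ := measureReal_univ_pos
  rw [integral_sub (hfμ.comp_fst ν) (hfν.comp_snd μ), integral_fun_fst, integral_fun_snd,
    average_eq, average_eq]
  simp only [smul_eq_mul]
  field_simp

theorem ofReal_sq_average_sub_average_le [IsFiniteMeasure μ] [IsFiniteMeasure ν] [NeZero μ]
    [NeZero ν] (hfμ : MemLp f 2 μ) (hfν : MemLp f 2 ν) :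
    ENNReal.ofReal ((⨍ x, f x ∂μ - ⨍ x, f x ∂ν) ^ 2) ≤
      (∫⁻ z, ENNReal.ofReal ((f z.1 - f z.2) ^ 2) ∂(μ.prod ν)) / (μ univ * ν univ) := by
  have hM : (μ univ * ν univ).toReal = μ.real univ * ν.real univ := ENNReal.toReal_mul
  have hM0 : μ univ * ν univ ≠ 0 := by simp [NeZero.ne]
  have hMtop : μ univ * ν univ ≠ ⊤ := by finiteness
  have hsq := ofReal_sq_integral_le ((hfμ.comp_fst ν).sub (hfν.comp_snd μ))
  rw [← univ_prod_univ, Measure.prod_prod] at hsq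
  rw [average_sub_average_eq (hfμ.integrable one_le_two) (hfν.integrable one_le_two), ← hM, div_pow,
    ENNReal.ofReal_div_of_pos (pow_pos (ENNReal.toReal_pos hM0 hMtop) 2),
    ENNReal.ofReal_pow ENNReal.toReal_nonneg, ENNReal.ofReal_toReal hMtop]
  refine ENNReal.div_le_of_le_mul ?_
  rwa [pow_two (_ * _ : ℝ≥0∞), ← mul_assoc, ENNReal.div_mul_cancel hM0 hMtop, mul_comm]

theorem tendsto_setAverage_of_tendsto_smallSets [TopologicalSpace X] (hf : LocallyIntegrable f μ)
    {p : X} (hp : ContinuousAt f p) {ι : Type*} {l : Filter ι} {S : ι → Set X}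
    (hS : Tendsto S l (𝓝 p).smallSets) (hSm : ∀ i, MeasurableSet (S i)) (hS0 : ∀ i, μ (S i) ≠ 0)
    (hS_top : ∀ i, μ (S i) ≠ ⊤) :
    Tendsto (fun i => ⨍ x in S i, f x ∂μ) l (𝓝 (f p)) := by
  refine Metric.nhds_basis_closedBall.tendsto_right_iff.2 fun ε hε => ?_
  obtain ⟨U, hU, hfU⟩ := hf p
  filter_upwards [hS (eventually_smallSets_subset.2 hU),
    hS (eventually_smallSets_subset.2 (hp (Metric.closedBall_mem_nhds (f p) hε)))] with i hiU hi
  exact (convex_closedBall (f p) ε).set_average_mem Metric.isClosed_closedBall (hS0 i) (hS_top i)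
    (ae_restrict_of_forall_mem (hSm i) fun x hx => hi hx) (hfU.mono_set hiU)

end Averages

section Slobodeckij

variable {Ω : Set ℝ} {σ : ℝ} {f : Ω → ℝ}

theorem ofReal_sq_setAverage_sub_setAverage_le [IsFiniteMeasure (lebesgueOn Ω)]
    (hσ : 0 ≤ 1 + 2 * σ) (hf : MemLp f 2 (lebesgueOn Ω)) {I J : Set Ω} (hI : MeasurableSet I)
    (hJ : MeasurableSet J) (hI0 : lebesgueOn Ω I ≠ 0) (hJ0 : lebesgueOn Ω J ≠ 0) {L : ℝ}
    (hIJ : ∀ x ∈ I, ∀ y ∈ J, |(x : ℝ) - y| ≤ L) :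
    ENNReal.ofReal ((⨍ x in I, f x ∂(lebesgueOn Ω) - ⨍ x in J, f x ∂(lebesgueOn Ω)) ^ 2) ≤
      ENNReal.ofReal (L ^ (1 + 2 * σ)) * slobodeckijEnergy Ω σ f /
        (lebesgueOn Ω I * lebesgueOn Ω J) := by
  have : NeZero ((lebesgueOn Ω).restrict I) := ⟨Measure.restrict_eq_zero.not.2 hI0⟩
  have : NeZero ((lebesgueOn Ω).restrict J) := ⟨Measure.restrict_eq_zero.not.2 hJ0⟩
  refine (ofReal_sq_average_sub_average_le (hf.restrict I) (hf.restrict J)).trans ?_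
  rw [Measure.restrict_apply_univ, Measure.restrict_apply_univ, Measure.prod_restrict]
  gcongr
  rw [slobodeckijEnergy, ← lintegral_const_mul' _ _ ENNReal.ofReal_ne_top]
  refine (setLIntegral_mono' (hI.prod hJ) fun z hz => ?_).trans (setLIntegral_le_lintegral _ _)
  have hzL := hIJ z.1 hz.1 z.2 hz.2
  have hL : 0 ≤ L := (abs_nonneg _).trans hzL
  rw [← ENNReal.ofReal_mul (by positivity)]
  refine ENNReal.ofReal_le_ofReal ?_
  rcases eq_or_ne z.1 z.2 with heq | hne
  · simp [heq]
  · have hpos : 0 < |(z.1 : ℝ) - z.2| := abs_pos.2 (sub_ne_zero.2 (Subtype.coe_ne_coe.2 hne))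
    rw [← mul_div_assoc, le_div_iff₀ (by positivity), mul_comm]
    gcongr

theorem abs_setAverage_sub_setAverage_le [IsFiniteMeasure (lebesgueOn Ω)] (hσ : 0 ≤ 1 + 2 * σ)
    (hf : MemLp f 2 (lebesgueOn Ω)) {D : ℝ} (hD : 0 ≤ D)
    (hE : slobodeckijEnergy Ω σ f ≤ ENNReal.ofReal (D ^ 2)) {I J : Set Ω} (hI : MeasurableSet I)
    (hJ : MeasurableSet J) {l : ℝ} (hl : 0 < l) (hIl : lebesgueOn Ω I = ENNReal.ofReal l)
    (hJl : lebesgueOn Ω J = ENNReal.ofReal (l / 2))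
    (hIJ : ∀ x ∈ I, ∀ y ∈ J, |(x : ℝ) - y| ≤ 2 * l) :
    |⨍ x in I, f x ∂(lebesgueOn Ω) - ⨍ x in J, f x ∂(lebesgueOn Ω)| ≤
      2 ^ (1 + σ) * D * l ^ (σ - 1 / 2) := by
  have hI0 : lebesgueOn Ω I ≠ 0 := by
    rwa [hIl, ENNReal.ofReal_ne_zero_iff]
  have hJ0 : lebesgueOn Ω J ≠ 0 := by
    rw [hJl, ENNReal.ofReal_ne_zero_iff]
    positivity
  have hpow : (2 * l) ^ (1 + 2 * σ) * D ^ 2 / (l * (l / 2)) =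
      (2 ^ (1 + σ) * D * l ^ (σ - 1 / 2)) ^ 2 := by
    have htwo : (2 : ℝ) ^ (1 + 2 * σ) * 2 = (2 ^ (1 + σ)) ^ 2 := by
      rw [← Real.rpow_add_one two_ne_zero, ← Real.rpow_mul_natCast zero_le_two]
      congr 1
      push_cast
      ring
    have hlpow : l ^ (1 + 2 * σ) = (l ^ (σ - 1 / 2)) ^ 2 * l ^ 2 := by
      rw [← Real.rpow_natCast l, ← Real.rpow_mul_natCast hl.le, ← Real.rpow_add hl]
      congr 1
      push_cast
      ring
    rw [Real.mul_rpow zero_le_two hl.le, mul_pow, mul_pow, ← htwo, hlpow]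
    field_simp
  refine abs_le_of_sq_le_sq ?_ (by positivity)
  rw [← ENNReal.ofReal_le_ofReal_iff (by positivity), ← hpow,
    ENNReal.ofReal_div_of_pos (by positivity), ENNReal.ofReal_mul (by positivity),
    ENNReal.ofReal_mul hl.le, ← hIl, ← hJl]
  exact (ofReal_sq_setAverage_sub_setAverage_le hσ hf hI hJ hI0 hJ0 hIJ).trans (by gcongr)

theorem abs_setAverage_sub_le_of_dyadic [IsFiniteMeasure (lebesgueOn Ω)] (hσ : 1 / 2 < σ)
    (hf : MemLp f 2 (lebesgueOn Ω)) {D : ℝ} (hD : 0 ≤ D)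
    (hE : slobodeckijEnergy Ω σ f ≤ ENNReal.ofReal (D ^ 2)) {p : Ω} (hp : ContinuousAt f p)
    {l : ℝ} (hl : 0 < l) {S : ℕ → Set Ω} (hS : ∀ n, MeasurableSet (S n))
    (hvol : ∀ n, lebesgueOn Ω (S n) = ENNReal.ofReal (l * (1 / 2) ^ n))
    (hball : ∀ n, S n ⊆ Metric.closedBall p (l * (1 / 2) ^ n)) :
    |⨍ x in S 0, f x ∂(lebesgueOn Ω) - f p| ≤
      2 ^ (1 + σ) * D * l ^ (σ - 1 / 2) / (1 - (1 / 2) ^ (σ - 1 / 2)) := by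
  have hS0 (n : ℕ) : lebesgueOn Ω (S n) ≠ 0 := by
    rw [hvol, ENNReal.ofReal_ne_zero_iff]
    positivity
  have hstep (n : ℕ) : dist (⨍ x in S n, f x ∂(lebesgueOn Ω))
      (⨍ x in S (n + 1), f x ∂(lebesgueOn Ω)) ≤
      2 ^ (1 + σ) * D * l ^ (σ - 1 / 2) * ((1 / 2) ^ (σ - 1 / 2)) ^ n := by
    have hpow : (l * (1 / 2) ^ n) ^ (σ - 1 / 2) =
        l ^ (σ - 1 / 2) * ((1 / 2) ^ (σ - 1 / 2)) ^ n := by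
      rw [Real.mul_rpow hl.le (by positivity), ← Real.rpow_pow_comm (by norm_num)]
    rw [mul_assoc, ← hpow]
    refine abs_setAverage_sub_setAverage_le (by linarith) hf hD hE (hS n) (hS (n + 1))
      (by positivity) (hvol n) (by rw [hvol, pow_succ]; congr 1; ring) fun x hx y hy => ?_
    have hxp : dist x p ≤ l * (1 / 2) ^ n := hball n hx
    have hyp : dist y p ≤ l * (1 / 2) ^ (n + 1) := hball (n + 1) hy
    rw [pow_succ] at hyp
    have htri : |(x : ℝ) - y| ≤ dist x p + dist y p := dist_triangle_right x y p
    linarith [show 0 < l * (1 / 2) ^ n by positivity]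
  have hradius : Tendsto (fun n : ℕ => l * (1 / 2) ^ n) atTop (𝓝 0) := by
    simpa using (tendsto_pow_atTop_nhds_zero_of_lt_one (one_half_pos (α := ℝ)).le
      one_half_lt_one).const_mul l
  have hsmall : Tendsto S atTop (𝓝 p).smallSets := by
    refine tendsto_smallSets_iff.2 fun U hU => ?_
    obtain ⟨ε, hε, hεU⟩ := Metric.nhds_basis_closedBall.mem_iff.1 hU
    filter_upwards [hradius.eventually_le_const hε] with n hn
    exact ((hball n).trans (Metric.closedBall_subset_closedBall hn)).trans hεU
  exact dist_le_of_le_geometric_of_tendsto₀ _ _ (Real.rpow_lt_one (by norm_num) (by norm_num)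
    (by linarith)) hstep (tendsto_setAverage_of_tendsto_smallSets
      (hf.integrable one_le_two).locallyIntegrable hp hsmall hS hS0 fun n => measure_ne_top _ _)

theorem lebesgueOn_preimage_Ioc (hΩ : MeasurableSet Ω) {u v : ℝ} (huv : Ioc u v ⊆ Ω) :
    lebesgueOn Ω ((↑) ⁻¹' Ioc u v) = ENNReal.ofReal (v - u) := by
  rw [comap_subtype_coe_apply hΩ, Subtype.image_preimage_coe, inter_eq_self_of_subset_right huv,
    Real.volume_Ioc]

theorem abs_sub_le_of_slobodeckijEnergy_le [IsFiniteMeasure (lebesgueOn Ω)]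
    (hΩ : MeasurableSet Ω) (hσ : 1 / 2 < σ) (hf : MemLp f 2 (lebesgueOn Ω)) (hfc : Continuous f)
    {D : ℝ} (hD : 0 ≤ D) (hE : slobodeckijEnergy Ω σ f ≤ ENNReal.ofReal (D ^ 2)) {x y : Ω}
    (hxy : (x : ℝ) < y) (hsub : Ioc (x : ℝ) y ⊆ Ω) :
    |f x - f y| ≤
      2 * (2 ^ (1 + σ) * D / (1 - (1 / 2) ^ (σ - 1 / 2))) * (y - x : ℝ) ^ (σ - 1 / 2) := by
  set l : ℝ := y - x with hl
  have hl0 : 0 < l := sub_pos.2 hxy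
  have hle (n : ℕ) : l * (1 / 2) ^ n ≤ l :=
    mul_le_of_le_one_right hl0.le (pow_le_one₀ (by norm_num) (by norm_num))
  have hx := abs_setAverage_sub_le_of_dyadic hσ hf hD hE (p := x) hfc.continuousAt hl0
    (S := fun n => (↑) ⁻¹' Ioc (x : ℝ) (x + l * (1 / 2) ^ n))
    (fun n => measurable_subtype_coe measurableSet_Ioc)
    (fun n => by
      rw [lebesgueOn_preimage_Ioc hΩ ((Ioc_subset_Ioc_right (by linarith [hle n])).trans hsub),
        add_sub_cancel_left])
    (fun n z hz => by
      rw [Metric.mem_closedBall, Subtype.dist_eq, Real.dist_eq, abs_of_pos (sub_pos.2 hz.1)]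
      linarith [hz.2])
  have hy := abs_setAverage_sub_le_of_dyadic hσ hf hD hE (p := y) hfc.continuousAt hl0
    (S := fun n => (↑) ⁻¹' Ioc (y - l * (1 / 2) ^ n) (y : ℝ))
    (fun n => measurable_subtype_coe measurableSet_Ioc)
    (fun n => by
      rw [lebesgueOn_preimage_Ioc hΩ ((Ioc_subset_Ioc_left (by linarith [hle n])).trans hsub),
        sub_sub_cancel])
    (fun n z hz => by
      rw [Metric.mem_closedBall', Subtype.dist_eq, Real.dist_eq, abs_of_nonneg (sub_nonneg.2 hz.2)]
      linarith [hz.1])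
  simp only [pow_zero, mul_one, hl, add_sub_cancel, sub_sub_cancel] at hx hy
  rw [← hl] at hx hy
  refine (abs_sub_le _ (⨍ z in (↑) ⁻¹' Ioc (x : ℝ) y, f z ∂(lebesgueOn Ω)) _).trans ?_
  rw [abs_sub_comm (f x)]
  refine (add_le_add hx hy).trans_eq ?_
  ring

end Slobodeckij

/-! ### Functions with an integrable first weak derivative -/

section FirstWeakDerivative

variable {a b : ℝ}

theorem exists_isTestFunction_deriv_eq {φ : ℝ → ℝ} (hφ : IsTestFunction (Ioo a b) φ)
    (hint : ∫ x, φ x = 0) : ∃ ψ, IsTestFunction (Ioo a b) ψ ∧ deriv ψ = φ := by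
  have hK : IsCompact (tsupport φ) := hφ.hasCompactSupport
  rcases (tsupport φ).eq_empty_or_nonempty with hempty | hne
  · exact ⟨φ, hφ, by rw [tsupport_eq_empty_iff.1 hempty, deriv_zero]⟩
  set c := sInf (tsupport φ)
  set d := sSup (tsupport φ)
  have hcd : Icc c d ⊆ Ioo a b := ordConnected_Ioo.out (hφ.tsupport_subset (hK.sInf_mem hne))
    (hφ.tsupport_subset (hK.sSup_mem hne))
  have hφ0 {t : ℝ} (ht : t ∉ Icc c d) : φ t = 0 := image_eq_zero_of_notMem_tsupport fun hmem =>
    ht ⟨csInf_le hK.bddBelow hmem, le_csSup hK.bddAbove hmem⟩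
  set ψ : ℝ → ℝ := fun x => ∫ t in Iic x, φ t
  have hψ : ψ = fun x => ψ 0 + ∫ t in 0..x, φ t := funext fun x => by
    rw [← intervalIntegral.integral_Iic_sub_Iic hφ.integrable.integrableOn
      hφ.integrable.integrableOn, add_sub_cancel]
  have hderiv (x : ℝ) : HasDerivAt ψ (φ x) x := by
    rw [hψ]
    exact (hφ.continuous.integral_hasStrictDerivAt 0 x).hasDerivAt.const_add _
  have hψ0 : ∀ x ∉ Icc c d, ψ x = 0 := fun x hx => by
    rcases not_and_or.1 hx with hxc | hxd
    · exact setIntegral_eq_zero_of_forall_eq_zero fun t ht =>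
        hφ0 fun htcd => hxc (htcd.1.trans ht)
    · rw [← hint]
      exact setIntegral_eq_integral_of_forall_compl_eq_zero fun t ht =>
        hφ0 fun htcd => ht (htcd.2.trans (not_le.1 hxd).le)
  have hderiv' : deriv ψ = φ := funext fun x => (hderiv x).deriv
  refine ⟨ψ, ⟨contDiff_infty_iff_deriv.2 ⟨fun x => (hderiv x).differentiableAt, ?_⟩,
    HasCompactSupport.intro isCompact_Icc hψ0, ?_⟩, hderiv'⟩
  · exact hderiv'.symm ▸ hφ.contDiff
  · exact (closure_minimal (Function.support_subset_iff'.2 hψ0) isClosed_Icc).trans hcd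

theorem exists_isTestFunction_integral_eq_one {Ω : Set ℝ} (hΩ : IsOpen Ω) (hne : Ω.Nonempty) :
    ∃ φ, IsTestFunction Ω φ ∧ ∫ x, φ x = 1 := by
  obtain ⟨x, hx⟩ := hne
  obtain ⟨ε, hε, hεΩ⟩ := Metric.nhds_basis_closedBall.mem_iff.1 (hΩ.mem_nhds hx)
  set β : ContDiffBump x := ⟨ε / 2, ε, half_pos hε, half_lt_self hε⟩
  exact ⟨β.normed volume, ⟨β.contDiff_normed, β.hasCompactSupport_normed,
    β.tsupport_normed_eq.subset.trans hεΩ⟩, β.integral_normed⟩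

/-- Any test function is a multiple of a fixed one with integral `1` up to the derivative of a test
function, and the latter is annihilated by `f`. -/
theorem HasWeakDeriv.exists_ae_eq_const (hab : a < b) {f : Ioo a b → ℝ}
    (h : HasWeakDeriv (Ioo a b) 1 f 0) : ∃ c, f =ᵐ[lebesgueOn (Ioo a b)] fun _ => c := by
  obtain ⟨φ₀, hφ₀, hint⟩ := exists_isTestFunction_integral_eq_one isOpen_Ioo (nonempty_Ioo.2 hab)
  set c := ∫ x : Ioo a b, f x * φ₀ x ∂(lebesgueOn (Ioo a b))
  have hc (φ : ℝ → ℝ) (hφ : IsTestFunction (Ioo a b) φ) :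
      ∫ x : Ioo a b, c * φ x ∂(lebesgueOn (Ioo a b)) = c * ∫ x, φ x := by
    rw [hφ.integral_lebesgueOn_mul measurableSet_Ioo fun _ => c, integral_const_mul]
  have hsub := h.1.sub (locallyIntegrable_const c)
  suffices hzero : f - (fun _ => c) =ᵐ[lebesgueOn (Ioo a b)] 0 from
    ⟨c, hzero.mono fun x hx => sub_eq_zero.1 hx⟩
  refine ae_eq_zero_of_forall_integral_mul_testFunction isOpen_Ioo hsub fun φ hφ => ?_
  set m := ∫ x, φ x with hm
  have hmean : ∫ x, (φ - m • φ₀) x = 0 := by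
    simp only [Pi.sub_apply, Pi.smul_apply, smul_eq_mul]
    rw [integral_sub hφ.integrable (hφ₀.integrable.const_mul m), integral_const_mul, hint, mul_one,
      hm, sub_self]
  obtain ⟨ψ, hψ, hψ'⟩ := exists_isTestFunction_deriv_eq (hφ.sub (hφ₀.const_smul m)) hmean
  have hparts := h.integral_mul_iteratedDeriv hψ
  simp only [iteratedDeriv_one, hψ', Pi.sub_apply, Pi.smul_apply, smul_eq_mul, Pi.zero_apply,
    zero_mul, integral_zero, mul_zero, mul_sub, mul_left_comm _ m] at hparts
  rw [integral_sub (hφ.integrable_mul h.1) ((hφ₀.integrable_mul h.1).const_mul m),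
    integral_const_mul] at hparts
  simp only [Pi.sub_apply, sub_mul]
  rw [integral_sub (hφ.integrable_mul h.1) (hφ.integrable_mul (locallyIntegrable_const c)),
    hc φ hφ, mul_comm c]
  exact hparts

theorem hasWeakDeriv_intervalIntegral (hab : a ≤ b) {g : ℝ → ℝ}
    (hg : IntervalIntegrable g volume a b) :
    HasWeakDeriv (Ioo a b) 1 (fun x => ∫ t in a..x, g t) (fun x => g x) := by
  set G : ℝ → ℝ := fun x => ∫ t in a..x, g t
  have hG := hg.absolutelyContinuousOnInterval_intervalIntegral left_mem_uIcc
  have hloc {u : ℝ → ℝ} (hu : IntegrableOn u (Ioo a b)) :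
      LocallyIntegrable (fun x : Ioo a b => u x) (lebesgueOn (Ioo a b)) := by
    rw [integrableOn_iff_comap_subtypeVal measurableSet_Ioo] at hu
    exact hu.locallyIntegrable
  refine ⟨hloc (hG.continuousOn.intervalIntegrable.1.mono_set Ioo_subset_Ioc_self),
    hloc (hg.1.mono_set Ioo_subset_Ioc_self), fun φ hφ hc hs => ?_⟩
  have hφ : IsTestFunction (Ioo a b) φ := ⟨hφ, hc, hs⟩
  have hint (u : ℝ → ℝ) (ψ : ℝ → ℝ) :
      ∫ x : Ioo a b, u x * ψ x ∂(lebesgueOn (Ioo a b)) = ∫ x in a..b, u x * ψ x := by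
    rw [integral_subtype_comap measurableSet_Ioo fun x => u x * ψ x,
      intervalIntegral.integral_of_le hab, integral_Ioc_eq_integral_Ioo]
  have hderiv : ∫ x in a..b, deriv G x * φ x = ∫ x in a..b, g x * φ x := by
    refine intervalIntegral.integral_congr_ae ?_
    filter_upwards [hg.ae_hasDerivAt_integral] with x hx hxab
    rw [(hx (uIoc_subset_uIcc hxab) a left_mem_uIcc).deriv]
  have hφac : AbsolutelyContinuousOnInterval φ a b :=
    (hφ.contDiff.of_le (by exact_mod_cast le_top)).contDiffOn.absolutelyContinuousOnInterval
  rw [iteratedDeriv_one, hint G, hint g, hG.integral_mul_deriv_eq_deriv_mul hφac, hderiv,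
    hφ.eq_zero_of_notMem left_notMem_Ioo, hφ.eq_zero_of_notMem right_notMem_Ioo]
  ring

theorem HasWeakDeriv.sub_eq_setIntegral {f g : Ioo a b → ℝ} (hf : Continuous f)
    (h : HasWeakDeriv (Ioo a b) 1 f g) (hg : Integrable g (lebesgueOn (Ioo a b))) {x y : Ioo a b}
    (hxy : x ≤ y) :
    f y - f x = ∫ z in Ioc x y, g z ∂(lebesgueOn (Ioo a b)) := by
  have hab : a < b := x.2.1.trans x.2.2
  set g' : ℝ → ℝ := Function.extend (↑) g 0
  have hg' (z : Ioo a b) : g' z = g z := Subtype.val_injective.extend_apply g 0 z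
  have hg'i : IntervalIntegrable g' volume a b := by
    rw [intervalIntegrable_iff_integrableOn_Ioo_of_le hab.le,
      integrableOn_iff_comap_subtypeVal measurableSet_Ioo]
    exact hg.congr (ae_of_all _ fun z => (hg' z).symm)
  set G : ℝ → ℝ := fun z => ∫ t in a..z, g' t
  have hG := hasWeakDeriv_intervalIntegral hab.le hg'i
  have hGc : Continuous fun z : Ioo a b => G z :=
    ((hg'i.absolutelyContinuousOnInterval_intervalIntegral left_mem_uIcc).continuousOn.mono
      (Ioo_subset_Icc_self.trans Icc_subset_uIcc)).domRestrict
  have hzero := h.sub hG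
  simp only [hg'] at hzero
  obtain ⟨c, hc⟩ := HasWeakDeriv.exists_ae_eq_const hab (sub_self g ▸ hzero)
  have hconst := funext_iff.1 ((hf.sub hGc).ae_eq_iff_eq _ continuous_const |>.1 hc)
  have hG_sub : G y - G x = ∫ t in Ioc (x : ℝ) y, g' t := by
    have hii (z : Ioo a b) : IntervalIntegrable g' volume a z :=
      hg'i.mono_set (uIcc_subset_uIcc_left (Icc_subset_uIcc (Ioo_subset_Icc_self z.2)))
    rw [intervalIntegral.integral_interval_sub_left (hii y) (hii x),
      intervalIntegral.integral_of_le hxy]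
  have hsub : Ioc (x : ℝ) y ⊆ Ioo a b :=
    (Ioc_subset_Ioc_left x.2.1.le).trans (Ioc_subset_Ioo_right y.2.2)
  calc f y - f x = G y - G x := by
        have hx := hconst x
        have hy := hconst y
        simp only [Pi.sub_apply] at hx hy
        linarith
    _ = ∫ t in Ioc (x : ℝ) y, g' t ∂(volume.restrict (Ioo a b)) := by
        rw [hG_sub, Measure.restrict_restrict_of_subset hsub]
    _ = ∫ z in Ioc x y, g' z ∂(lebesgueOn (Ioo a b)) := by
        rw [← map_comap_subtype_coe measurableSet_Ioo,
          (MeasurableEmbedding.subtype_coe measurableSet_Ioo).setIntegral_map]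
        rfl
    _ = ∫ z in Ioc x y, g z ∂(lebesgueOn (Ioo a b)) := by simp only [hg']

theorem HasWeakDeriv.abs_sub_le_of_lintegral_sq_le {f g : Ioo a b → ℝ} {D : ℝ} (hf : Continuous f)
    (h : HasWeakDeriv (Ioo a b) 1 f g) (hD : 0 ≤ D)
    (hg : ∫⁻ z, ENNReal.ofReal (g z ^ 2) ∂(lebesgueOn (Ioo a b)) ≤ ENNReal.ofReal (D ^ 2))
    {x y : Ioo a b} (hxy : x ≤ y) : |f x - f y| ≤ D * (y - x : ℝ) ^ (1 / 2 : ℝ) := by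
  have hg2 : MemLp g 2 (lebesgueOn (Ioo a b)) := by
    refine (memLp_two_iff_integrable_sq h.aemeasurable.aestronglyMeasurable).2 ?_
    exact (lintegral_ofReal_ne_top_iff_integrable
      (h.aemeasurable.pow_const 2).aestronglyMeasurable (ae_of_all _ fun _ => sq_nonneg _)).1
      (ne_top_of_le_ne_top ENNReal.ofReal_ne_top hg)
  have hxy' : (0 : ℝ) ≤ y - x := sub_nonneg.2 hxy
  have hsq : ENNReal.ofReal ((f y - f x) ^ 2) ≤ ENNReal.ofReal ((y - x) * D ^ 2) := by
    rw [h.sub_eq_setIntegral hf (hg2.integrable one_le_two) hxy, ENNReal.ofReal_mul hxy']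
    refine (ofReal_sq_integral_le (hg2.restrict _)).trans (mul_le_mul' ?_ ?_)
    · rw [Measure.restrict_apply_univ, ← lebesgueOn_preimage_Ioc measurableSet_Ioo
        ((Ioc_subset_Ioc_left x.2.1.le).trans (Ioc_subset_Ioo_right y.2.2))]
      rfl
    · exact (setLIntegral_le_lintegral _ _).trans hg
  rw [abs_sub_comm, ← Real.sqrt_eq_rpow]
  refine abs_le_of_sq_le_sq ?_ (by positivity)
  rw [mul_pow, Real.sq_sqrt hxy', mul_comm]
  exact (ENNReal.ofReal_le_ofReal_iff (by positivity)).1 hsq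

end FirstWeakDerivative

theorem exists_holder_bound_of_sobolevENormSq_le (a b : ℝ) {t D : ℝ} (ht : 1 / 2 < t)
    (hD : 0 ≤ D) :
    ∃ C α : ℝ, 0 ≤ C ∧ 0 < α ∧ ∀ f : Ioo a b →ᵇ ℝ,
      sobolevENormSq (Ioo a b) t f ≤ ENNReal.ofReal (D ^ 2) →
      ∀ x y : Ioo a b, x < y → |f x - f y| ≤ C * (y - x : ℝ) ^ α := by
  rcases Nat.eq_zero_or_pos ⌊t⌋₊ with hfloor | hfloor
  · have hratio : (1 / 2 : ℝ) ^ (t - 1 / 2) < 1 :=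
      Real.rpow_lt_one (by norm_num) (by norm_num) (by linarith)
    refine ⟨2 * (2 ^ (1 + t) * D / (1 - (1 / 2) ^ (t - 1 / 2))), t - 1 / 2,
      mul_nonneg zero_le_two (div_nonneg (by positivity) (sub_pos.2 hratio).le), sub_pos.2 ht,
      fun f hf x y hxy => ?_⟩
    have hE : slobodeckijEnergy (Ioo a b) t f ≤ ENNReal.ofReal (D ^ 2) := by
      refine le_trans ?_ hf
      rw [sobolevENormSq_eq_sobolevForm isOpen_Ioo (g := fun _ => f) fun k hk => by
        rw [Nat.le_zero.1 (hk.trans_eq hfloor)]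
        exact hasWeakDeriv_zero (f.integrable _).locallyIntegrable]
      have hle := slobodeckijEnergy_le_sobolevForm (Ω := Ioo a b) (s := t) (fun _ => f)
        (by rw [hfloor, Nat.cast_zero]; linarith)
      rwa [hfloor, Nat.cast_zero, sub_zero] at hle
    exact abs_sub_le_of_slobodeckijEnergy_le measurableSet_Ioo ht (f.memLp_top.mono_exponent le_top)
      f.continuous hD hE hxy
        ((Ioc_subset_Ioc_left x.2.1.le).trans (Ioc_subset_Ioo_right y.2.2))
  · refine ⟨D, 1 / 2, hD, by norm_num, fun f hf x y hxy => ?_⟩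
    have hweak := hasWeakDeriv_weakDeriv_of_sobolevENormSq_ne_top
      (ne_top_of_le_ne_top ENNReal.ofReal_ne_top hf)
    refine (hweak 1 hfloor).abs_sub_le_of_lintegral_sq_le f.continuous hD ?_ hxy.le
    rw [sobolevENormSq_eq_sobolevForm isOpen_Ioo hweak] at hf
    exact (lintegral_sq_le_sobolevForm (fun k => weakDeriv _ k f) hfloor).trans hf

/-! ### Sobolev balls are closed in the sup norm -/

section Midpoint

variable {X : Type*} [AddCommGroup X] [Module ℝ X] {Q : X → ℝ≥0∞} {S : ℕ → Set X} {E : ℝ≥0∞}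

theorem le_four_mul_of_midpoint_le {A : Set X} (hA : Convex ℝ A) {f h : X} (hf : f ∈ A)
    (hh : h ∈ A) (hmid : Q (midpoint ℝ f h) + 4⁻¹ * Q (f - h) ≤ 2⁻¹ * (Q f + Q h))
    (hinf : ⨅ q ∈ A, Q q ≠ ⊤) (hfE : Q f ≤ E) (hhE : Q h ≤ E) :
    Q (f - h) ≤ 4 * (E - ⨅ q ∈ A, Q q) := by
  have hadd : (⨅ q ∈ A, Q q) + 4⁻¹ * Q (f - h) ≤ E :=
    calc (⨅ q ∈ A, Q q) + 4⁻¹ * Q (f - h)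
      _ ≤ Q (midpoint ℝ f h) + 4⁻¹ * Q (f - h) := by
        gcongr
        exact iInf₂_le _ (hA.midpoint_mem hf hh)
      _ ≤ 2⁻¹ * (Q f + Q h) := hmid
      _ ≤ 2⁻¹ * (E + E) := by gcongr
      _ = E := by rw [mul_add, ← add_mul, ENNReal.inv_two_add_inv_two, one_mul]
  have hquarter := ENNReal.le_sub_of_add_le_left hinf hadd
  rwa [← ENNReal.div_eq_inv_mul, ENNReal.div_le_iff' (by simp) (by simp)] at hquarter

theorem exists_forall_mem_forall_lt_of_midpoint_le (hS : Antitone S) (hconv : ∀ n, Convex ℝ (S n))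
    (hne : ∀ n, (S n).Nonempty) (hE : E ≠ ⊤) (hSE : ∀ q ∈ S 0, Q q ≤ E)
    (hmid : ∀ f ∈ S 0, ∀ h ∈ S 0,
      Q (midpoint ℝ f h) + 4⁻¹ * Q (f - h) ≤ 2⁻¹ * (Q f + Q h))
    {η : ℕ → ℝ≥0∞} (hη : ∀ N, 0 < η N) :
    ∃ q : ℕ → X, (∀ n, q n ∈ S n) ∧ ∀ N n m, N ≤ n → N ≤ m → Q (q n - q m) < η N := by
  set d : ℕ → ℝ≥0∞ := fun n => ⨅ q ∈ S n, Q q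
  have hd : Monotone d := fun n m hnm => biInf_mono fun q hq => hS hnm hq
  have hdE (n : ℕ) : d n ≤ E := by
    obtain ⟨q, hq⟩ := hne n
    exact (iInf₂_le q hq).trans (hSE q (hS n.zero_le hq))
  have hsup : ⨆ n, d n ≠ ⊤ := ne_top_of_le_ne_top hE (iSup_le hdE)
  set u : ℕ → ℝ≥0∞ := fun N => (⨆ n, d n) + (N : ℝ≥0∞)⁻¹
  have hu : Tendsto u atTop (𝓝 (⨆ n, d n)) := by
    simpa only [add_zero] using tendsto_const_nhds.add ENNReal.tendsto_inv_nat_nhds_zero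
  have hgap : Tendsto (fun N => 4 * (u N - d N)) atTop (𝓝 0) := by
    simpa using ENNReal.Tendsto.const_mul
      (ENNReal.Tendsto.sub hu (tendsto_atTop_iSup hd) (.inl hsup)) (.inr ENNReal.ofNat_ne_top)
  have hmin (n : ℕ) : ∃ q ∈ S n, Q q < u n := by
    have hlt : d n < u n := (le_iSup d n).trans_lt (ENNReal.lt_add_right hsup (by simp))
    simpa only [d, iInf_lt_iff, exists_prop] using hlt
  choose q hq hqu using hmin
  have hanti : Antitone u := fun n m hnm => by simp only [u]; gcongr
  obtain ⟨φ, hφ, hφη⟩ := extraction_forall_of_eventually fun N => hgap.eventually_lt_const (hη N)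
  refine ⟨q ∘ φ, fun n => hS (hφ.id_le n) (hq _), fun N n m hn hm => (hφη N).trans_le' ?_⟩
  have hmem {n : ℕ} (hn : N ≤ n) : q (φ n) ∈ S (φ N) := hS (hφ.monotone hn) (hq _)
  have hle {n : ℕ} (hn : N ≤ n) : Q (q (φ n)) ≤ u (φ N) :=
    (hqu _).le.trans (hanti (hφ.monotone hn))
  exact le_four_mul_of_midpoint_le (hconv _) (hmem hn) (hmem hm)
    (hmid _ (hS (φ N).zero_le (hmem hn)) _ (hS (φ N).zero_le (hmem hm)))
    (ne_top_of_le_ne_top hE (hdE _)) (hle hn) (hle hm)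

end Midpoint

section LimitsInLp

variable {X : Type*} [MeasurableSpace X] {μ : Measure X}

theorem eLpNorm_two_sq (u : X → ℝ) :
    eLpNorm u 2 μ ^ 2 = ∫⁻ x, ENNReal.ofReal (u x ^ 2) ∂μ := by
  have hnorm := eLpNorm_nnreal_pow_eq_lintegral (μ := μ) (f := u) (p := 2) two_ne_zero
  simp only [ENNReal.coe_ofNat, NNReal.coe_ofNat, ENNReal.rpow_ofNat] at hnorm
  rw [hnorm]
  refine lintegral_congr fun x => ?_
  rw [Real.enorm_eq_ofReal_abs, ← ENNReal.ofReal_pow (abs_nonneg _), sq_abs]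

theorem exists_tendsto_of_lintegral_sq_sub_lt {g : ℕ → X → ℝ} (hg : ∀ n, AEMeasurable (g n) μ)
    (h : ∀ N n m, N ≤ n → N ≤ m →
      ∫⁻ x, ENNReal.ofReal ((g n x - g m x) ^ 2) ∂μ < (2⁻¹ ^ N) ^ 2) :
    ∃ G : X → ℝ, AEMeasurable G μ ∧ (∀ᵐ x ∂μ, Tendsto (fun n => g n x) atTop (𝓝 (G x))) ∧
      Tendsto (fun n => eLpNorm (g n - G) 2 μ) atTop (𝓝 0) := by
  have hmeas (n : ℕ) : AEStronglyMeasurable (g n) μ := (hg n).aestronglyMeasurable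
  have hsum : ∑' n : ℕ, (2⁻¹ : ℝ≥0∞) ^ n ≠ ⊤ := by simp [ENNReal.tsum_geometric]
  have hcauchy (N n m : ℕ) (hn : N ≤ n) (hm : N ≤ m) : eLpNorm (g n - g m) 2 μ < 2⁻¹ ^ N := by
    refine lt_of_pow_lt_pow_left' 2 ?_
    rw [eLpNorm_two_sq]
    exact h N n m hn hm
  have hae := Lp.ae_tendsto_of_cauchy_eLpNorm hmeas one_le_two hsum hcauchy
  obtain ⟨G, hG, hlim⟩ := exists_stronglyMeasurable_limit_of_tendsto_ae hmeas hae
  exact ⟨G, hG.measurable.aemeasurable, hlim,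
    Lp.cauchy_tendsto_of_tendsto hmeas G hsum hcauchy hlim⟩

theorem lintegral_ofReal_le_liminf {u : ℕ → X → ℝ} {v : X → ℝ} (hu : ∀ n, AEMeasurable (u n) μ)
    (h : ∀ᵐ x ∂μ, Tendsto (fun n => u n x) atTop (𝓝 (v x))) :
    ∫⁻ x, ENNReal.ofReal (v x) ∂μ ≤ liminf (fun n => ∫⁻ x, ENNReal.ofReal (u n x) ∂μ) atTop :=
  calc ∫⁻ x, ENNReal.ofReal (v x) ∂μ
    _ = ∫⁻ x, liminf (fun n => ENNReal.ofReal (u n x)) atTop ∂μ := by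
      refine lintegral_congr_ae ?_
      filter_upwards [h] with x hx using (ENNReal.tendsto_ofReal hx).liminf_eq.symm
    _ ≤ _ := lintegral_liminf_le' fun n => (hu n).ennreal_ofReal

theorem liminf_add_liminf_le_liminf_add (u v : ℕ → ℝ≥0∞) :
    liminf u atTop + liminf v atTop ≤ liminf (u + v) atTop := by
  have hmono (w : ℕ → ℝ≥0∞) : Monotone fun n => ⨅ i ≥ n, w i :=
    fun n m hnm => biInf_mono fun i hi => hnm.trans hi
  simp only [liminf_eq_iSup_iInf_of_nat]
  rw [ENNReal.iSup_add_iSup_of_monotone (hmono u) (hmono v)]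
  exact iSup_mono fun n => le_iInf₂ fun i hi => add_le_add (iInf₂_le i hi) (iInf₂_le i hi)

theorem sum_liminf_le_liminf_sum {ι : Type*} (s : Finset ι) (u : ι → ℕ → ℝ≥0∞) :
    ∑ i ∈ s, liminf (u i) atTop ≤ liminf (fun n => ∑ i ∈ s, u i n) atTop := by
  rw [← Finset.sum_fn]
  exact Finset.sum_hom_rel (r := fun c w => c ≤ liminf w atTop) zero_le fun i c w hcw =>
    (add_le_add le_rfl hcw).trans (liminf_add_liminf_le_liminf_add (u i) w)

end LimitsInLp

theorem sobolevForm_le_liminf {Ω : Set ℝ} {s : ℝ} {g : ℕ → ℕ → Ω → ℝ} {G : ℕ → Ω → ℝ}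
    (hg : ∀ n, ∀ k ≤ ⌊s⌋₊, AEMeasurable (g n k) (lebesgueOn Ω))
    (h : ∀ k ≤ ⌊s⌋₊, ∀ᵐ x ∂(lebesgueOn Ω), Tendsto (fun n => g n k x) atTop (𝓝 (G k x))) :
    sobolevForm Ω s G ≤ liminf (fun n => sobolevForm Ω s (g n)) atTop := by
  refine (add_le_add ?_ ?_).trans (liminf_add_liminf_le_liminf_add _ _)
  · refine (Finset.sum_le_sum fun k hk => ?_).trans (sum_liminf_le_liminf_sum _ _)
    have hk := Finset.mem_range_succ_iff.1 hk
    refine lintegral_ofReal_le_liminf (fun n => (hg n k hk).pow_const 2) ?_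
    filter_upwards [h k hk] with x hx using hx.pow 2
  · split_ifs
    · exact zero_le
    · refine lintegral_ofReal_le_liminf (fun n =>
        ((aemeasurable_increment (hg n _ le_rfl)).pow_const 2).div
          (Measurable.aemeasurable (by fun_prop))) ?_
      filter_upwards [Measure.quasiMeasurePreserving_fst.ae (h _ le_rfl),
        Measure.quasiMeasurePreserving_snd.ae (h _ le_rfl)] with z hz₁ hz₂
      exact ((hz₁.sub hz₂).pow 2).div_const _

theorem IsTestFunction.memLp {Ω : Set ℝ} {φ : ℝ → ℝ} (hφ : IsTestFunction Ω φ)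
    (hΩ : MeasurableSet Ω) (p : ℝ≥0∞) : MemLp (fun x : Ω => φ x) p (lebesgueOn Ω) := by
  refine MemLp.comp_of_map ?_ measurable_subtype_coe.aemeasurable
  rw [map_comap_subtype_coe hΩ]
  exact (hφ.continuous.memLp_of_hasCompactSupport hφ.hasCompactSupport).restrict Ω

theorem IsTestFunction.tendsto_integral_mul {Ω : Set ℝ} {φ : ℝ → ℝ} (hφ : IsTestFunction Ω φ)
    (hΩ : MeasurableSet Ω) {p : ℝ≥0∞} (hp : 1 ≤ p) {u : ℕ → Ω → ℝ} {v : Ω → ℝ}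
    (hu : ∀ n, LocallyIntegrable (u n) (lebesgueOn Ω)) (hv : LocallyIntegrable v (lebesgueOn Ω))
    (h : Tendsto (fun n => eLpNorm (u n - v) p (lebesgueOn Ω)) atTop (𝓝 0)) :
    Tendsto (fun n => ∫ x : Ω, u n x * φ x ∂(lebesgueOn Ω)) atTop
      (𝓝 (∫ x : Ω, v x * φ x ∂(lebesgueOn Ω))) := by
  have : p.HolderConjugate p.conjExponent := ENNReal.HolderConjugate.conjExponent hp
  have hφp := hφ.memLp hΩ p.conjExponent
  refine tendsto_integral_of_L1' _ (hφ.integrable_mul hv).aestronglyMeasurable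
    (Eventually.of_forall fun n => hφ.integrable_mul (hu n)) ?_
  have hbound : Tendsto (fun n => eLpNorm (u n - v) p (lebesgueOn Ω) *
      eLpNorm (fun x : Ω => φ x) p.conjExponent (lebesgueOn Ω)) atTop (𝓝 0) := by
    simpa using ENNReal.Tendsto.mul_const h (.inr hφp.eLpNorm_ne_top)
  refine tendsto_of_tendsto_of_tendsto_of_le_of_le tendsto_const_nhds hbound
    (fun _ => zero_le) fun n => ?_
  have hsub : AEStronglyMeasurable (u n - v) (lebesgueOn Ω) :=
    (hu n).aestronglyMeasurable.sub hv.aestronglyMeasurable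
  have holder := eLpNorm_smul_le_mul_eLpNorm (p := p) (q := p.conjExponent) (r := 1) hφp.1 hsub
  rwa [smul_eq_mul, sub_mul] at holder

theorem HasWeakDeriv.of_tendsto_eLpNorm {Ω : Set ℝ} (hΩ : MeasurableSet Ω) {k : ℕ}
    {p r : ℝ≥0∞} (hp : 1 ≤ p) (hr : 1 ≤ r) {f : ℕ → Ω → ℝ} {F : Ω → ℝ} {g : ℕ → Ω → ℝ}
    {G : Ω → ℝ} (hfg : ∀ n, HasWeakDeriv Ω k (f n) (g n))
    (hF : LocallyIntegrable F (lebesgueOn Ω)) (hG : LocallyIntegrable G (lebesgueOn Ω))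
    (hfF : Tendsto (fun n => eLpNorm (f n - F) p (lebesgueOn Ω)) atTop (𝓝 0))
    (hgG : Tendsto (fun n => eLpNorm (g n - G) r (lebesgueOn Ω)) atTop (𝓝 0)) :
    HasWeakDeriv Ω k F G := by
  refine ⟨hF, hG, fun φ hφ hc hs => ?_⟩
  have hφ : IsTestFunction Ω φ := ⟨hφ, hc, hs⟩
  refine tendsto_nhds_unique
    ((hφ.iteratedDeriv k).tendsto_integral_mul hΩ hp (fun n => (hfg n).1) hF hfF) ?_
  simp only [(hfg _).integral_mul_iteratedDeriv hφ]
  exact (hφ.tendsto_integral_mul hΩ hr (fun n => (hfg n).2.1) hG hgG).const_mul _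

section SobolevBall

variable {Ω : Set ℝ} {s : ℝ} {E : ℝ≥0∞}

theorem convex_setOf_sobolevENormSq_le [SFinite (lebesgueOn Ω)] (hΩ : IsOpen Ω) (hE : E ≠ ⊤) :
    Convex ℝ {f : Ω →ᵇ ℝ | sobolevENormSq Ω s f ≤ E} := by
  intro f hf h hh c d hc hd hcd
  have hident := sobolevENormSq_smul_add_smul hΩ (ne_top_of_le_ne_top hE hf)
    (ne_top_of_le_ne_top hE hh) hc hd hcd
  calc sobolevENormSq Ω s (c • f + d • h : Ω →ᵇ ℝ)
    _ ≤ ENNReal.ofReal c * sobolevENormSq Ω s f + ENNReal.ofReal d * sobolevENormSq Ω s h :=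
      le_self_add.trans hident.le
    _ ≤ ENNReal.ofReal c * E + ENNReal.ofReal d * E := by gcongr <;> assumption
    _ = E := by rw [← add_mul, ← ENNReal.ofReal_add hc hd, hcd, ENNReal.ofReal_one, one_mul]

theorem sobolevENormSq_midpoint_add [SFinite (lebesgueOn Ω)] (hΩ : IsOpen Ω) {f h : Ω →ᵇ ℝ}
    (hf : sobolevENormSq Ω s f ≠ ⊤) (hh : sobolevENormSq Ω s h ≠ ⊤) :
    sobolevENormSq Ω s (midpoint ℝ f h : Ω →ᵇ ℝ) +
        4⁻¹ * sobolevENormSq Ω s (f - h : Ω →ᵇ ℝ) =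
      2⁻¹ * (sobolevENormSq Ω s f + sobolevENormSq Ω s h) := by
  have hident := sobolevENormSq_smul_add_smul hΩ hf hh (c := 2⁻¹) (d := 2⁻¹)
    (by norm_num) (by norm_num) (by norm_num)
  have hquarter : ENNReal.ofReal (2⁻¹ * 2⁻¹) = 4⁻¹ := by
    rw [← mul_inv, ENNReal.ofReal_inv_of_pos (by norm_num)]
    norm_num
  rw [hquarter, ENNReal.ofReal_inv_of_pos two_pos, ENNReal.ofReal_ofNat, ← mul_add] at hident
  rw [← hident, midpoint_eq_smul_add, invOf_eq_inv, smul_add]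
  rfl

theorem sobolevENormSq_le_of_tendsto [IsFiniteMeasure (lebesgueOn Ω)] (hΩ : IsOpen Ω)
    {q : ℕ → Ω →ᵇ ℝ} {f : Ω →ᵇ ℝ} (hE : E ≠ ⊤) (hq : Tendsto q atTop (𝓝 f))
    (hqE : ∀ n, sobolevENormSq Ω s (q n) ≤ E)
    (hcauchy : ∀ N n m, N ≤ n → N ≤ m → sobolevENormSq Ω s (q n - q m) < (2⁻¹ ^ N) ^ 2) :
    sobolevENormSq Ω s f ≤ E := by
  have hderiv (n : ℕ) := hasWeakDeriv_weakDeriv_of_sobolevENormSq_ne_top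
    (ne_top_of_le_ne_top hE (hqE n))
  have hlim (k : ℕ) (hk : k ≤ ⌊s⌋₊) := exists_tendsto_of_lintegral_sq_sub_lt
    (fun n => (hderiv n k hk).aemeasurable) fun N n m hn hm => by
      refine (hcauchy N n m hn hm).trans_le' ?_
      rw [sobolevENormSq_eq_sobolevForm hΩ fun k hk => (hderiv n k hk).sub (hderiv m k hk)]
      exact lintegral_sq_le_sobolevForm (fun k => weakDeriv Ω k (q n) - weakDeriv Ω k (q m)) hk
  choose! G hGmeas hGae hGlim using hlim
  have hform : sobolevForm Ω s G ≤ E := by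
    refine (sobolevForm_le_liminf (fun n k hk => (hderiv n k hk).aemeasurable) hGae).trans
      (liminf_le_of_frequently_le' (Frequently.of_forall fun n => ?_))
    rw [← sobolevENormSq_eq_sobolevForm hΩ (hderiv n)]
    exact hqE n
  have hGint (k : ℕ) (hk : k ≤ ⌊s⌋₊) : MemLp (G k) 2 (lebesgueOn Ω) := by
    refine ⟨(hGmeas k hk).aestronglyMeasurable, lt_top_iff_ne_top.2 fun htop => ?_⟩
    have hsq := (lintegral_sq_le_sobolevForm G hk).trans hform
    rw [← eLpNorm_two_sq, htop] at hsq
    exact hE (top_le_iff.1 hsq)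
  have hsup : Tendsto (fun n => eLpNorm (q n - f) ∞ (lebesgueOn Ω)) atTop (𝓝 0) := by
    refine tendsto_of_tendsto_of_tendsto_of_le_of_le tendsto_const_nhds ?_ (fun _ => zero_le)
      fun n => (eLpNorm_exponent_top.trans_le <| eLpNormEssSup_le_of_ae_bound <|
        Eventually.of_forall (q n - f).norm_coe_le_norm)
    simpa using ENNReal.tendsto_ofReal (tendsto_iff_norm_sub_tendsto_zero.1 hq)
  rwa [sobolevENormSq_eq_sobolevForm hΩ fun k hk => HasWeakDeriv.of_tendsto_eLpNorm
    hΩ.measurableSet le_top one_le_two (fun n => hderiv n k hk)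
    (f.integrable _).locallyIntegrable ((hGint k hk).locallyIntegrable one_le_two)
    hsup (hGlim k hk)]

theorem isClosed_setOf_sobolevENormSq_le [IsFiniteMeasure (lebesgueOn Ω)] (hΩ : IsOpen Ω)
    (hE : E ≠ ⊤) : IsClosed {f : Ω →ᵇ ℝ | sobolevENormSq Ω s f ≤ E} := by
  refine isClosed_of_closure_subset fun f hf => ?_
  set S : ℕ → Set (Ω →ᵇ ℝ) := fun n =>
    {q | sobolevENormSq Ω s q ≤ E} ∩ Metric.ball f (1 / (n + 1))
  have hSanti : Antitone S := fun n m hnm =>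
    inter_subset_inter_right _ (Metric.ball_subset_ball (Nat.one_div_le_one_div hnm))
  have hSne (n : ℕ) : (S n).Nonempty := by
    simpa only [S, inter_comm] using
      mem_closure_iff.1 hf _ Metric.isOpen_ball (Metric.mem_ball_self Nat.one_div_pos_of_nat)
  obtain ⟨q, hqS, hcauchy⟩ := exists_forall_mem_forall_lt_of_midpoint_le
    (Q := fun q : Ω →ᵇ ℝ => sobolevENormSq Ω s q) hSanti
    (fun n => (convex_setOf_sobolevENormSq_le hΩ hE).inter (convex_ball f _)) hSne hE
    (fun q hq => hq.1) (fun q hq h hh => (sobolevENormSq_midpoint_add hΩ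
      (ne_top_of_le_ne_top hE hq.1) (ne_top_of_le_ne_top hE hh.1)).le)
    (η := fun N => (2⁻¹ ^ N) ^ 2) fun N => by simp [pos_iff_ne_zero]
  have hqf : Tendsto q atTop (𝓝 f) := tendsto_iff_dist_tendsto_zero.2 <|
    squeeze_zero (fun _ => dist_nonneg) (fun n => (hqS n).2.le)
      tendsto_one_div_add_atTop_nhds_zero_nat
  exact sobolevENormSq_le_of_tendsto hΩ hE hqf (fun n => (hqS n).1) hcauchy

end SobolevBall

/-! ### Compactness and convexity of the model -/

theorem totallyBounded_of_uniformEquicontinuous {X β : Type*} [UniformSpace X]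
    [PseudoMetricSpace β] (hX : TotallyBounded (univ : Set X)) {S : Set (X →ᵇ β)}
    (hS : UniformEquicontinuous fun f : S => ⇑(f : X →ᵇ β))
    (hSx : ∀ x, TotallyBounded ((fun f : X →ᵇ β => f x) '' S)) : TotallyBounded S := by
  rw [totallyBounded_iff_ultrafilter]
  intro U hU
  refine Metric.cauchy_iff.2 ⟨U.neBot, fun ε hε => ?_⟩
  have hε4 : 0 < ε / 4 := by positivity
  obtain ⟨T, hT, hXT⟩ := hX _ (hS _ (Metric.dist_mem_uniformity hε4))
  have hUx (x : X) : ∃ A ∈ U, ∀ f ∈ A, ∀ g ∈ A, dist (f x) (g x) < ε / 4 := by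
    have hcauchy := totallyBounded_iff_ultrafilter.1 (hSx x) (U.map fun f : X →ᵇ β => f x)
      (le_principal_iff.2 <| Ultrafilter.mem_map.2 <|
        mem_of_superset (le_principal_iff.1 hU) (subset_preimage_image _ S))
    obtain ⟨B, hB, hBε⟩ := (Metric.cauchy_iff.1 hcauchy).2 _ hε4
    exact ⟨_, hB, fun f hf g hg => hBε _ hf _ hg⟩
  choose A hAU hA using hUx
  refine ⟨S ∩ ⋂ x ∈ T, A x, inter_mem (le_principal_iff.1 hU)
    ((biInter_mem hT).2 fun x _ => hAU x), fun f hf g hg => ?_⟩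
  refine lt_of_le_of_lt ((BoundedContinuousFunction.dist_le (C := 3 * (ε / 4))
    (by positivity)).2 fun x => ?_) (by linarith)
  obtain ⟨y, hyT, hxy⟩ := mem_iUnion₂.1 (hXT (mem_univ x))
  have hfx : dist (f x) (f y) < ε / 4 := hxy ⟨f, hf.1⟩
  have hgx : dist (g x) (g y) < ε / 4 := hxy ⟨g, hg.1⟩
  have hfg := hA y f (mem_iInter₂.1 hf.2 y hyT) g (mem_iInter₂.1 hg.2 y hyT)
  linarith [dist_triangle4 (f x) (f y) (g y) (g x), dist_comm (g x) (g y)]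

section DensityModel

variable {Ω : Set ℝ} {a b t ζ D : ℝ}

theorem mem_densityModel_iff [IsFiniteMeasure (lebesgueOn Ω)] (hD : 0 ≤ D) {p : Ω →ᵇ ℝ} :
    p ∈ densityModel Ω t ζ D ↔ sobolevENormSq Ω t p ≤ ENNReal.ofReal (D ^ 2) ∧
      ∫ x, p x ∂(lebesgueOn Ω) = 1 ∧ ∀ x, ζ ≤ p x := by
  rw [← sobolevENorm_le_ofReal_iff hD]
  exact ⟨fun ⟨_, hint, hζ, hnorm⟩ => ⟨hnorm, hint, hζ⟩, fun ⟨hnorm, hint, hζ⟩ =>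
    ⟨⟨p.memLp_top.mono_exponent le_top, hnorm.trans_lt ENNReal.ofReal_lt_top⟩,
      hint, hζ, hnorm⟩⟩

theorem convex_setOf_integral_eq {X : Type*} [TopologicalSpace X] [MeasurableSpace X]
    [OpensMeasurableSpace X] (μ : Measure X) [IsFiniteMeasure μ] (c : ℝ) :
    Convex ℝ {p : X →ᵇ ℝ | ∫ x, p x ∂μ = c} := by
  intro p hp q hq r s _ _ hrs
  simp only [mem_ofPred_eq, BoundedContinuousFunction.coe_add, BoundedContinuousFunction.coe_smul,
    Pi.add_apply, smul_eq_mul] at hp hq ⊢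
  rw [integral_add ((p.integrable μ).const_mul r) ((q.integrable μ).const_mul s),
    integral_const_mul, integral_const_mul, hp, hq, ← add_mul, hrs, one_mul]

theorem convex_setOf_forall_le {X : Type*} [TopologicalSpace X] (c : ℝ) :
    Convex ℝ {p : X →ᵇ ℝ | ∀ x, c ≤ p x} :=
  fun _ hp _ hq _ _ hr hs hrs x => convex_Ici c (hp x) (hq x) hr hs hrs

theorem continuous_integral_boundedContinuousFunction {X : Type*} [TopologicalSpace X]
    [MeasurableSpace X] [BorelSpace X] (μ : Measure X) [IsFiniteMeasure μ] :
    Continuous fun p : X →ᵇ ℝ => ∫ x, p x ∂μ := by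
  refine (continuous_integral.comp
    (BoundedContinuousFunction.toLp (E := ℝ) 1 μ ℝ).continuous).congr fun p => ?_
  exact integral_congr_ae (BoundedContinuousFunction.coeFn_toLp 1 μ ℝ p)

theorem densityModel_eq_inter [IsFiniteMeasure (lebesgueOn Ω)] (hD : 0 ≤ D) :
    densityModel Ω t ζ D = {p : Ω →ᵇ ℝ | sobolevENormSq Ω t p ≤ ENNReal.ofReal (D ^ 2)} ∩
      ({p : Ω →ᵇ ℝ | ∫ x, p x ∂(lebesgueOn Ω) = 1} ∩ {p | ∀ x, ζ ≤ p x}) :=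
  Set.ext fun _ => mem_densityModel_iff hD

theorem convex_densityModel [IsFiniteMeasure (lebesgueOn Ω)] (hΩ : IsOpen Ω) (hD : 0 ≤ D) :
    Convex ℝ (densityModel Ω t ζ D) := by
  rw [densityModel_eq_inter hD]
  exact (convex_setOf_sobolevENormSq_le hΩ ENNReal.ofReal_ne_top).inter <|
    (convex_setOf_integral_eq (lebesgueOn Ω) 1).inter (convex_setOf_forall_le ζ)

theorem isClosed_densityModel [IsFiniteMeasure (lebesgueOn Ω)] (hΩ : IsOpen Ω) (hD : 0 ≤ D) :
    IsClosed (densityModel Ω t ζ D) := by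
  rw [densityModel_eq_inter hD, ofPred_forall]
  exact (isClosed_setOf_sobolevENormSq_le hΩ ENNReal.ofReal_ne_top).inter <|
    (isClosed_eq (continuous_integral_boundedContinuousFunction (lebesgueOn Ω))
      continuous_const).inter <| isClosed_iInter fun x =>
        isClosed_le continuous_const (BoundedContinuousFunction.evalCLM ℝ x).continuous

theorem exists_dist_le_of_mem_densityModel (a b ζ : ℝ) (ht : 1 / 2 < t) (hD : 0 ≤ D) :
    ∃ C α : ℝ, 0 ≤ C ∧ 0 < α ∧ ∀ p ∈ densityModel (Ioo a b) t ζ D, ∀ x y,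
      dist (p x) (p y) ≤ C * dist x y ^ α := by
  obtain ⟨C, α, hC, hα, hholder⟩ := exists_holder_bound_of_sobolevENormSq_le a b ht hD
  refine ⟨C, α, hC, hα, fun p hp x y => ?_⟩
  wlog! hxy : x < y generalizing x y
  · rcases hxy.eq_or_lt with rfl | hyx
    · simp [Real.zero_rpow hα.ne']
    · rw [dist_comm (p x), dist_comm x]
      exact this y x hyx
  rw [Real.dist_eq, dist_comm x, Subtype.dist_eq, Real.dist_eq,
    abs_of_pos (sub_pos.2 (Subtype.coe_lt_coe.2 hxy))]
  exact hholder p ((mem_densityModel_iff hD).1 hp).1 x y hxy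

theorem exists_le_inv_of_mem_densityModel (hab : a < b) {p : Ioo a b →ᵇ ℝ}
    (hp : p ∈ densityModel (Ioo a b) t ζ D) : ∃ y, p y ≤ (b - a)⁻¹ := by
  have hvol := measureReal_lebesgueOn_Ioo_univ hab.le
  have hne : lebesgueOn (Ioo a b) ≠ 0 := by
    intro h
    rw [h, measureReal_zero_apply] at hvol
    linarith
  obtain ⟨y, hy⟩ := exists_le_average hne (p.integrable (lebesgueOn (Ioo a b)))
  rw [average_eq, hp.2.1, hvol, smul_eq_mul, mul_one] at hy
  exact ⟨y, hy⟩

theorem isCompact_densityModel (hab : a < b) (ht : 1 / 2 < t) (hD : 0 ≤ D) :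
    IsCompact (densityModel (Ioo a b) t ζ D) := by
  obtain ⟨C, α, hC, hα, hholder⟩ := exists_dist_le_of_mem_densityModel a b ζ ht hD
  refine (totallyBounded_of_uniformEquicontinuous ?_ ?_ fun x => ?_).isCompact_of_isClosed
    (isClosed_densityModel isOpen_Ioo hD)
  · rw [← totallyBounded_image_iff isUniformEmbedding_subtype_val.isUniformInducing, image_univ,
      Subtype.range_coe]
    exact totallyBounded_Ioo a b
  · refine Metric.uniformEquicontinuous_of_continuity_modulus (fun r => C * r ^ α) ?_ _
      fun x y p => hholder p p.2 x y
    simpa [Real.zero_rpow hα.ne'] using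
      (Real.continuousAt_rpow_const 0 α (Or.inr hα.le)).tendsto.const_mul C
  · refine (totallyBounded_Icc ζ ((b - a)⁻¹ + C * (b - a) ^ α)).subset ?_
    rintro _ ⟨p, hp, rfl⟩
    obtain ⟨y, hy⟩ := exists_le_inv_of_mem_densityModel hab hp
    have hxy : dist x y ≤ b - a :=
      Real.dist_le_of_mem_Icc (Ioo_subset_Icc_self x.2) (Ioo_subset_Icc_self y.2)
    have hosc := (le_abs_self (p x - p y)).trans <| (hholder p hp x y).trans <|
      mul_le_mul_of_nonneg_left (Real.rpow_le_rpow dist_nonneg hxy hα.le) hC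
    exact ⟨hp.2.2.1 x, by linarith⟩

end DensityModel

/-! ### Mixtures with peaked densities -/

theorem exists_contDiff_eqOn_one_integral_le {s : Set ℝ} (hs : IsClosed s) (hs0 : volume s = 0)
    {ε : ℝ} (hε : 0 < ε) : ∃ G : ℝ → ℝ, ContDiff ℝ ∞ G ∧ (∀ z, G z ∈ Icc 0 1) ∧ EqOn G 1 s ∧
      Integrable G ∧ ∫ z, G z ≤ ε := by
  obtain ⟨U, hsU, hU, hUε⟩ :=
    s.exists_isOpen_lt_of_lt (ENNReal.ofReal ε) (hs0.trans_lt (ENNReal.ofReal_pos.2 hε))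
  obtain ⟨G, hG0, hG1, hG⟩ := exists_contMDiffMap_zero_one_of_isClosed (n := (⊤ : ℕ∞))
    (modelWithCornersSelf ℝ ℝ) hU.isClosed_compl hs (disjoint_compl_left_iff_subset.2 hsU)
  have hsmooth : ContDiff ℝ ∞ G := G.contMDiff.contDiff
  have hind : Integrable (U.indicator 1 : ℝ → ℝ) :=
    (integrable_indicator_iff hU.measurableSet).2
      (integrableOn_const (hUε.trans ENNReal.ofReal_lt_top).ne)
  have hle (z : ℝ) : G z ≤ U.indicator 1 z := by
    by_cases hz : z ∈ U
    · simpa [hz] using (hG z).2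
    · simp [hz, hG0 hz]
  have hint : Integrable G := hind.mono' hsmooth.continuous.aestronglyMeasurable
    (Eventually.of_forall fun z => (Real.norm_of_nonneg (hG z).1).trans_le (hle z))
  refine ⟨G, hsmooth, hG, hG1, hint, (integral_mono hint hind hle).trans ?_⟩
  rw [integral_indicator_one hU.measurableSet]
  exact ENNReal.toReal_le_of_le_ofReal hε.le hUε.le

section DensityModel

variable {Ω : Set ℝ} {a b t ζ D : ℝ}

theorem exists_density_gt (hab : a < b) (t : ℝ) (hζb : ζ < (b - a)⁻¹) {F : Set (Ioo a b)}
    (hF : F.Finite) (hFne : F.Nonempty) (B : ℝ) :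
    ∃ g : Ioo a b →ᵇ ℝ, ∫ z, g z ∂(lebesgueOn (Ioo a b)) = 1 ∧ (∀ z, ζ ≤ g z) ∧
      sobolevENormSq (Ioo a b) t g < ⊤ ∧ ∀ z ∈ F, B < g z := by
  have hba := sub_pos.2 hab
  set κ := 1 - ζ * (b - a)
  have hκ : 0 < κ := by
    rwa [sub_pos, ← lt_div_iff₀ hba, one_div]
  obtain ⟨G, hsmooth, hG, hGF, hGint, hGκ⟩ := exists_contDiff_eqOn_one_integral_le
    (s := Subtype.val '' F) (hF.image _).isClosed ((hF.image _).measure_zero _)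
    (ε := κ / (|B - ζ| + 1)) (by positivity)
  let G' : Ioo a b →ᵇ ℝ := .ofNormedAddCommGroup (fun z => G z)
    (hsmooth.continuous.comp continuous_subtype_val) 1
    fun z => (Real.norm_of_nonneg (hG z).1).trans_le (hG z).2
  set m := ∫ z, G' z ∂(lebesgueOn (Ioo a b)) with hm
  have hm0 : 0 < m := by
    obtain ⟨z, hz⟩ := hFne
    exact integral_pos_of_integrable_nonneg_nonzero G'.continuous (G'.integrable _)
      (fun z => (hG z).1) ((hGF (mem_image_of_mem _ hz)).trans_ne one_ne_zero)
  have hmκ : m ≤ κ / (|B - ζ| + 1) := calc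
    m = ∫ z in Ioo a b, G z := integral_subtype_comap measurableSet_Ioo G
    _ ≤ ∫ z, G z := setIntegral_le_integral hGint (Eventually.of_forall fun z => (hG z).1)
    _ ≤ _ := hGκ
  refine ⟨.const _ ζ + (κ / m) • G', ?_, fun z => ?_, ?_, fun z hz => ?_⟩
  · simp only [BoundedContinuousFunction.coe_add, BoundedContinuousFunction.coe_smul, Pi.add_apply,
      BoundedContinuousFunction.const_apply, smul_eq_mul]
    rw [integral_add (integrable_const _) ((G'.integrable _).const_mul _), integral_const,
      integral_const_mul, measureReal_lebesgueOn_Ioo_univ hab.le, ← hm, div_mul_cancel₀ _ hm0.ne',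
      smul_eq_mul]
    ring
  · exact le_add_of_nonneg_right (mul_nonneg (div_pos hκ hm0).le (hG z).1)
  · exact sobolevENormSq_lt_top_of_contDiff (contDiff_const.add (contDiff_const.mul hsmooth))
  · have hpeak : |B - ζ| + 1 ≤ κ / m := (le_div_comm₀ hm0 (by positivity)).1 hmκ
    change B < ζ + κ / m * G z
    rw [hGF (mem_image_of_mem _ hz), Pi.one_apply, mul_one]
    linarith [le_abs_self (B - ζ)]

theorem exists_mixture_mem_densityModel [IsFiniteMeasure (lebesgueOn Ω)] (hΩ : IsOpen Ω)
    {p g : Ω →ᵇ ℝ} (hD : 0 ≤ D)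
    (hp : p ∈ densityModel Ω t ζ D) (hpD : sobolevENormSq Ω t p < ENNReal.ofReal (D ^ 2))
    (hg1 : ∫ z, g z ∂(lebesgueOn Ω) = 1) (hgζ : ∀ z, ζ ≤ g z) (hg : sobolevENormSq Ω t g < ⊤) :
    ∃ ε ∈ Ioo (0 : ℝ) 1, (1 - ε) • p + ε • g ∈ densityModel Ω t ζ D := by
  have hlim : Tendsto (fun ε : ℝ => ENNReal.ofReal (1 - ε) * sobolevENormSq Ω t p +
      ENNReal.ofReal ε * sobolevENormSq Ω t g) (𝓝[>] 0) (𝓝 (sobolevENormSq Ω t p)) := by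
    have hcont := ((ENNReal.continuous_mul_const hpD.ne_top).comp
      (ENNReal.continuous_ofReal.comp (continuous_sub_left (1 : ℝ)))).add
      ((ENNReal.continuous_mul_const hg.ne).comp ENNReal.continuous_ofReal)
    exact (hcont.tendsto' 0 _ (by simp)).mono_left nhdsWithin_le_nhds
  obtain ⟨ε, hεD, hε⟩ :=
    ((hlim.eventually (gt_mem_nhds hpD)).and (Ioo_mem_nhdsGT one_pos)).exists
  have hmix := sobolevENormSq_smul_add_smul hΩ hpD.ne_top hg.ne (sub_nonneg.2 hε.2.le) hε.1.le
    (sub_add_cancel 1 ε)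
  have hdens := ((convex_setOf_integral_eq (lebesgueOn Ω) 1).inter (convex_setOf_forall_le ζ))
    ((mem_densityModel_iff hD).1 hp).2 (And.intro hg1 hgζ) (sub_nonneg.2 hε.2.le) hε.1.le
    (sub_add_cancel 1 ε)
  exact ⟨ε, hε, (mem_densityModel_iff hD).2 ⟨(le_self_add.trans hmix.le).trans hεD.le, hdens⟩⟩

theorem const_inv_mem_densityModel (hab : a < b) (hD : 0 ≤ D) (hζb : ζ ≤ (b - a)⁻¹)
    (hbD : (b - a)⁻¹ ≤ D ^ 2) :
    BoundedContinuousFunction.const (Ioo a b) (b - a)⁻¹ ∈ densityModel (Ioo a b) t ζ D := by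
  have hba : b - a ≠ 0 := (sub_pos.2 hab).ne'
  refine (mem_densityModel_iff hD).2 ⟨(sobolevENormSq_const a b t (b - a)⁻¹).trans_le ?_, ?_,
    fun _ => hζb⟩
  · rw [sq, inv_mul_cancel_right₀ hba]
    exact ENNReal.ofReal_le_ofReal hbD
  · simp [measureReal_lebesgueOn_Ioo_univ hab.le, hba]

theorem eq_zero_of_sobolevENormSq_eq_zero [IsFiniteMeasure (lebesgueOn Ω)]
    [(lebesgueOn Ω).IsOpenPosMeasure] (hΩ : IsOpen Ω) {f : Ω →ᵇ ℝ}
    (hf : sobolevENormSq Ω t f = 0) : f = 0 := by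
  have hderiv := hasWeakDeriv_weakDeriv_of_sobolevENormSq_ne_top (hf ▸ ENNReal.zero_ne_top)
  have hsq : ∫⁻ x : Ω, ENNReal.ofReal (weakDeriv Ω 0 f x ^ 2) ∂(lebesgueOn Ω) = 0 := by
    rw [← nonpos_iff_eq_zero, ← hf, sobolevENormSq_eq_sobolevForm hΩ hderiv]
    exact lintegral_sq_le_sobolevForm (fun k => weakDeriv Ω k f) (Nat.zero_le _)
  rw [lintegral_eq_zero_iff'
    ((hderiv 0 (Nat.zero_le _)).aemeasurable.pow_const 2).ennreal_ofReal] at hsq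
  have hae : ⇑f =ᵐ[lebesgueOn Ω] 0 := by
    filter_upwards [hsq, (hasWeakDeriv_zero (f.integrable _).locallyIntegrable).weakDeriv_ae_eq hΩ]
      with x hx hfx
    rw [Pi.zero_apply, ENNReal.ofReal_eq_zero, hfx] at hx
    exact sq_nonpos_iff _ |>.1 hx
  exact DFunLike.coe_injective ((f.continuous.ae_eq_iff_eq _ continuous_zero).1 hae)

end DensityModel

/-! ### Maximizers of the likelihood -/

theorem continuous_of_isMaxOn_of_unique {X Y R : Type*} [TopologicalSpace X] [TopologicalSpace Y]
    [TopologicalSpace R] [Preorder R] [OrderClosedTopology R] {K : Set Y} (hK : IsCompact K)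
    {L : X → Y → R} (hL : Continuous fun z : X × Y => L z.1 z.2) {F : X → Y} (hFK : ∀ x, F x ∈ K)
    (hF : ∀ x, IsMaxOn (L x) K (F x)) (huniq : ∀ x, ∀ y ∈ K, IsMaxOn (L x) K y → y = F x) :
    Continuous F := by
  refine continuous_iff_continuousAt.2 fun x => hK.tendsto_nhds_of_unique_mapClusterPt
    (Eventually.of_forall hFK) fun y hy hcluster => huniq x y hy fun z hz => ?_
  obtain ⟨U, hUx, hUy⟩ := mapClusterPt_iff_ultrafilter.1 hcluster
  have hLz : Tendsto (fun x' => L x' z) U (𝓝 (L x z)) :=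
    (hL.tendsto (x, z)).comp ((tendsto_id'.2 hUx).prodMk_nhds tendsto_const_nhds)
  have hLF : Tendsto (fun x' => L x' (F x')) U (𝓝 (L x y)) :=
    (hL.tendsto (x, y)).comp ((tendsto_id'.2 hUx).prodMk_nhds hUy)
  exact le_of_tendsto_of_tendsto' hLz hLF fun x' => hF x' hz

/-- `p` maximizes the likelihood `∏ i, q (x i)` of the data `x` among the members `q` of `M`. A
product is used instead of the sum of the logarithms, so that no value `-∞` occurs. -/
def IsLikelihoodMax {X ι : Type*} [TopologicalSpace X] [Fintype ι] (M : Set (X →ᵇ ℝ)) (x : ι → X)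
    (p : X →ᵇ ℝ) : Prop :=
  p ∈ M ∧ IsMaxOn (fun q : X →ᵇ ℝ => ∏ i, q (x i)) M p

section Likelihood

variable {X ι : Type*} [TopologicalSpace X] [Fintype ι] {M : Set (X →ᵇ ℝ)} {x : ι → X}
  {p q : X →ᵇ ℝ}

theorem continuous_likelihood :
    Continuous fun z : (ι → X) × (X →ᵇ ℝ) => ∏ i, z.2 (z.1 i) :=
  continuous_finsetProd _ fun i _ =>
    continuous_eval.comp (continuous_snd.prodMk ((continuous_apply i).comp continuous_fst))

theorem exists_isLikelihoodMax (hM : IsCompact M) (hne : M.Nonempty) (x : ι → X) :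
    ∃ p, IsLikelihoodMax M x p :=
  hM.exists_isMaxOn hne (continuous_likelihood.comp (Continuous.prodMk_right x)).continuousOn

theorem continuous_of_isLikelihoodMax_of_unique (hM : IsCompact M)
    (huniq : ∀ (x : ι → X) p q, IsLikelihoodMax M x p → IsLikelihoodMax M x q → p = q)
    {F : (ι → X) → (X →ᵇ ℝ)} (hF : ∀ x, IsLikelihoodMax M x (F x)) : Continuous F :=
  continuous_of_isMaxOn_of_unique hM continuous_likelihood (fun x => (hF x).1)
    (fun x => (hF x).2) fun x p hp hmax => huniq x p (F x) ⟨hp, hmax⟩ (hF x)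

theorem IsLikelihoodMax.pos (hp : IsLikelihoodMax M x p) (hM : ∀ i, 0 ≤ p (x i)) (hq : q ∈ M)
    (hqx : ∀ i, 0 < q (x i)) (i : ι) : 0 < p (x i) := by
  have hprod : 0 < ∏ i, p (x i) := (Finset.prod_pos fun i _ => hqx i).trans_le (hp.2 hq)
  exact (hM i).lt_of_ne' (Finset.prod_ne_zero_iff.1 hprod.ne' i (Finset.mem_univ i))

theorem IsLikelihoodMax.midpoint (hM : Convex ℝ M) (hM0 : ∀ q ∈ M, ∀ z, 0 ≤ q z)
    (hp : IsLikelihoodMax M x p) (hq : IsLikelihoodMax M x q) :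
    IsLikelihoodMax M x (midpoint ℝ p q) := by
  have hmem := hM.midpoint_mem hp.1 hq.1
  have hpq : ∏ i, p (x i) = ∏ i, q (x i) := le_antisymm (hq.2 hp.1) (hp.2 hq.1)
  suffices hle : ∏ i, p (x i) ≤ ∏ i, (_root_.midpoint ℝ p q) (x i) from
    ⟨hmem, fun r hr => le_trans (hp.2 hr) hle⟩
  refine le_of_sq_le_sq ?_ (Finset.prod_nonneg fun i _ => hM0 _ hmem _)
  have hmid (z : X) : _root_.midpoint ℝ p q z = 2⁻¹ * (p z + q z) := by
    simp [midpoint_eq_smul_add, mul_add]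
  -- the arithmetic mean dominates the geometric mean at every observation
  calc (∏ i, p (x i)) ^ 2 = ∏ i, p (x i) * q (x i) := by
        rw [Finset.prod_mul_distrib, ← hpq, sq]
    _ ≤ ∏ i, (_root_.midpoint ℝ p q) (x i) ^ 2 := by
        refine Finset.prod_le_prod
          (fun i _ => mul_nonneg (hM0 p hp.1 _) (hM0 q hq.1 _)) fun i _ => ?_
        rw [hmid]
        linarith [sq_nonneg (p (x i) - q (x i))]
    _ = (∏ i, (_root_.midpoint ℝ p q) (x i)) ^ 2 := Finset.prod_pow _ _ _

end Likelihood

theorem sum_log_eq_log_prod {ι : Type*} (s : Finset ι) (u : ι → ℝ≥0∞) :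
    ∑ i ∈ s, ENNReal.log (u i) = ENNReal.log (∏ i ∈ s, u i) := by
  classical
  induction s using Finset.induction_on with
  | empty => simp
  | insert i s hi ih => rw [Finset.sum_insert hi, Finset.prod_insert hi, ih, ENNReal.log_mul_add]

section LogLik

variable {Ω : Set ℝ} {n : ℕ}

theorem logLik_eq_log_prod_div {p : Ω → ℝ} (hp : ∀ z, 0 ≤ p z) (x : Fin n → Ω) :
    logLik p x = ENNReal.log (ENNReal.ofReal (∏ i, p (x i))) / (n : ℝ) := by
  rw [logLik, sum_log_eq_log_prod, ENNReal.ofReal_prod_of_nonneg fun i _ => hp _, one_div,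
    EReal.coe_inv, EReal.div_eq_inv_mul]

theorem logLik_le_logLik_iff (hn : 1 ≤ n) {p q : Ω → ℝ} (hp : ∀ z, 0 ≤ p z)
    (hq : ∀ z, 0 ≤ q z) (x : Fin n → Ω) :
    logLik p x ≤ logLik q x ↔ ∏ i, p (x i) ≤ ∏ i, q (x i) := by
  have hn0 : (0 : EReal) < (n : ℝ) := EReal.coe_pos.2 (Nat.cast_pos.2 hn)
  rw [logLik_eq_log_prod_div hp, logLik_eq_log_prod_div hq,
    (EReal.strictMono_div_right_of_pos hn0 (EReal.coe_ne_top _)).le_iff_le, ENNReal.log_le_log_iff,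
    ENNReal.ofReal_le_ofReal_iff (Finset.prod_nonneg fun i _ => hq _)]

theorem logLik_eq_iSup_iff (hn : 1 ≤ n) {M : Set (Ω →ᵇ ℝ)} (hM : ∀ q ∈ M, ∀ z, 0 ≤ q z)
    {x : Fin n → Ω} {p : M} :
    logLik p.1 x = ⨆ q : M, logLik q.1 x ↔ IsLikelihoodMax M x p.1 := by
  have hle (q : M) : logLik q.1 x ≤ logLik p.1 x ↔ ∏ i, q.1 (x i) ≤ ∏ i, p.1 (x i) :=
    logLik_le_logLik_iff hn (hM q q.2) (hM p p.2) x
  rw [← (le_iSup (fun q : M => logLik q.1 x) p).ge_iff_eq, iSup_le_iff]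
  exact ⟨fun h => ⟨p.2, fun q hq => (hle ⟨q, hq⟩).1 (h _)⟩, fun h q => (hle q).2 (h.2 q.2)⟩

end LogLik

section Maximizer

variable {a b t ζ D : ℝ} {ι : Type*} [Fintype ι] {x : ι → Ioo a b} {p q : Ioo a b →ᵇ ℝ}

theorem IsLikelihoodMax.sobolevENormSq_eq [Nonempty ι] (hab : a < b) (hζ : 0 ≤ ζ) (hD : 0 ≤ D)
    (hζb : ζ < (b - a)⁻¹) (hbD : (b - a)⁻¹ ≤ D ^ 2)
    (hp : IsLikelihoodMax (densityModel (Ioo a b) t ζ D) x p) :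
    sobolevENormSq (Ioo a b) t p = ENNReal.ofReal (D ^ 2) := by
  refine ((mem_densityModel_iff hD).1 hp.1).1.eq_of_not_lt fun hlt => ?_
  have hpos := hp.pos (fun i => hζ.trans (hp.1.2.2.1 _))
    (const_inv_mem_densityModel hab hD hζb.le hbD) fun _ => inv_pos.2 (sub_pos.2 hab)
  obtain ⟨g, hg1, hgζ, hg, hgx⟩ :=
    exists_density_gt hab t hζb (finite_range x) (range_nonempty x) ‖p‖
  obtain ⟨ε, hε, hmem⟩ := exists_mixture_mem_densityModel isOpen_Ioo hD hp.1 hlt hg1 hgζ hg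
  refine (hp.2 hmem).not_gt (Finset.prod_lt_prod_of_nonempty
    (fun i _ => hpos i) (fun i _ => ?_) Finset.univ_nonempty)
  have hpg : p (x i) < g (x i) :=
    (le_abs_self _).trans_lt ((p.norm_coe_le_norm _).trans_lt (hgx _ (mem_range_self i)))
  change p (x i) < (1 - ε) * p (x i) + ε * g (x i)
  linarith [mul_lt_mul_of_pos_left hpg hε.1]

theorem IsLikelihoodMax.sobolevENorm_eq [Nonempty ι] (hab : a < b) (hζ : 0 ≤ ζ) (hD : 0 ≤ D)
    (hζb : ζ < (b - a)⁻¹) (hbD : (b - a)⁻¹ ≤ D ^ 2)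
    (hp : IsLikelihoodMax (densityModel (Ioo a b) t ζ D) x p) :
    sobolevENorm (Ioo a b) t p = ENNReal.ofReal D := by
  rw [sobolevENorm, hp.sobolevENormSq_eq hab hζ hD hζb hbD,
    ENNReal.ofReal_rpow_of_nonneg (sq_nonneg D) (by norm_num), ← Real.sqrt_eq_rpow,
    Real.sqrt_sq hD]

theorem IsLikelihoodMax.unique [Nonempty ι] (hab : a < b) (hζ : 0 ≤ ζ) (hD : 0 ≤ D)
    (hζb : ζ < (b - a)⁻¹) (hbD : (b - a)⁻¹ ≤ D ^ 2)
    (hp : IsLikelihoodMax (densityModel (Ioo a b) t ζ D) x p)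
    (hq : IsLikelihoodMax (densityModel (Ioo a b) t ζ D) x q) : p = q := by
  have hmid := hp.midpoint (convex_densityModel isOpen_Ioo hD)
    (fun r hr z => hζ.trans (hr.2.2.1 z)) hq
  have hnorm {r : Ioo a b →ᵇ ℝ} (hr : IsLikelihoodMax (densityModel (Ioo a b) t ζ D) x r) :=
    hr.sobolevENormSq_eq hab hζ hD hζb hbD
  have hident := sobolevENormSq_midpoint_add isOpen_Ioo
    ((hnorm hp).trans_ne ENNReal.ofReal_ne_top) ((hnorm hq).trans_ne ENNReal.ofReal_ne_top)
  rw [hnorm hmid, hnorm hp, hnorm hq, ← two_mul, ENNReal.inv_mul_cancel_left two_ne_zero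
    ENNReal.ofNat_ne_top] at hident
  have hdiff := (ENNReal.add_right_inj ENNReal.ofReal_ne_top).1 (hident.trans (add_zero _).symm)
  refine sub_eq_zero.1 (eq_zero_of_sobolevENormSq_eq_zero (t := t) isOpen_Ioo ?_)
  exact (mul_eq_zero.1 hdiff).resolve_left (ENNReal.inv_ne_zero.2 ENNReal.ofNat_ne_top)

theorem existsUnique_isLikelihoodMax [Nonempty ι] (hab : a < b) (ht : 1 / 2 < t) (hζ : 0 ≤ ζ)
    (hD : 0 ≤ D) (hζb : ζ < (b - a)⁻¹) (hbD : (b - a)⁻¹ ≤ D ^ 2) (x : ι → Ioo a b) :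
    ∃! p : densityModel (Ioo a b) t ζ D, IsLikelihoodMax (densityModel (Ioo a b) t ζ D) x p.1 := by
  obtain ⟨p, hp⟩ := exists_isLikelihoodMax (isCompact_densityModel (ζ := ζ) hab ht hD)
    ⟨_, const_inv_mem_densityModel hab hD hζb.le hbD⟩ x
  exact ⟨⟨p, hp.1⟩, hp, fun q hq => Subtype.ext (hq.unique hab hζ hD hζb hbD hp)⟩

end Maximizer

theorem mainTheorem5_general {a b t ζ D : ℝ} (hab : a < b) (ht : 1 / 2 < t) (hζ : 0 ≤ ζ)
    (hD : 0 ≤ D) (hζb : ζ < (b - a)⁻¹) (hbD : (b - a)⁻¹ ≤ D ^ 2) {T V : Type*}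
    [TopologicalSpace T] [MeasurableSpace V] {ρ : V → T → Ioo a b}
    (hρ : ∀ θ, Measurable fun v => ρ v θ) {k : ℕ} (hk : 1 ≤ k) :
    (∀ (θ : T) (v : Fin k → V), ∃! p : densityModel (Ioo a b) t ζ D,
      simLogLik ρ θ p.1 v = ⨆ q : densityModel (Ioo a b) t ζ D, simLogLik ρ θ q.1 v) ∧
    ∀ ptilde : T → (Fin k → V) → densityModel (Ioo a b) t ζ D,
      (∀ θ v, simLogLik ρ θ (ptilde θ v).1 v =
        ⨆ q : densityModel (Ioo a b) t ζ D, simLogLik ρ θ q.1 v) →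
      (∀ θ, @Measurable (Fin k → V) (densityModel (Ioo a b) t ζ D)
        MeasurableSpace.pi (borel _) (ptilde θ)) ∧
      (∀ θ v, sobolevENorm (Ioo a b) t (ptilde θ v).1 = ENNReal.ofReal D) ∧
      ((∀ v, Continuous (ρ v)) → ∀ v, Continuous fun θ => ptilde θ v) := by
  have : Nonempty (Fin k) := Fin.pos_iff_nonempty.1 hk
  have hsim (θ : T) (v : Fin k → V) (p : densityModel (Ioo a b) t ζ D) :
      simLogLik ρ θ p.1 v = ⨆ q : densityModel (Ioo a b) t ζ D, simLogLik ρ θ q.1 v ↔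
        IsLikelihoodMax (densityModel (Ioo a b) t ζ D) (fun i => ρ (v i) θ) p.1 :=
    logLik_eq_iSup_iff hk fun q hq z => hζ.trans (hq.2.2.1 z)
  simp only [hsim]
  have hex := existsUnique_isLikelihoodMax (ι := Fin k) hab ht hζ hD hζb hbD
  refine ⟨fun θ v => hex _, fun ptilde h => ?_⟩
  choose phat hphat using fun x => (hex x).exists
  have hcont : Continuous phat := continuous_induced_rng.2 <|
    continuous_of_isLikelihoodMax_of_unique (isCompact_densityModel hab ht hD)
      (fun _ _ _ hp hq => hp.unique hab hζ hD hζb hbD hq) hphat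
  obtain rfl : ptilde = fun θ v => phat fun i => ρ (v i) θ :=
    funext₂ fun θ v => (hex _).unique (h θ v) (hphat _)
  refine ⟨fun θ => ?_, fun θ v => (hphat _).sobolevENorm_eq hab hζ hD hζb hbD,
    fun hρc v => hcont.comp (continuous_pi fun i => hρc (v i))⟩
  let _ : MeasurableSpace (densityModel (Ioo a b) t ζ D) := borel _
  have _ : BorelSpace (densityModel (Ioo a b) t ζ D) := ⟨rfl⟩
  exact hcont.measurable.comp <| measurable_pi_lambda _ fun i => (hρ θ).comp (measurable_pi_apply i)

theorem mainTheorem5 (a b t ζ D : ℝ) (hab : a < b) (ht : 1 / 2 < t) (hζ : 0 ≤ ζ) (hD : 0 < D)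
    (hζb : ζ < (b - a)⁻¹) (hbD : (b - a)⁻¹ < D ^ 2) :
    -- the estimator based on the observed data
    (∀ n : ℕ, 1 ≤ n →
      (∀ x : Fin n → Set.Ioo a b, ∃! p : densityModel (Set.Ioo a b) t ζ D,
        logLik p.1 x = ⨆ q : densityModel (Set.Ioo a b) t ζ D, logLik q.1 x) ∧
      ∀ phat : (Fin n → Set.Ioo a b) → densityModel (Set.Ioo a b) t ζ D,
        (∀ x, logLik (phat x).1 x = ⨆ q : densityModel (Set.Ioo a b) t ζ D, logLik q.1 x) →
        @Measurable (Fin n → Set.Ioo a b) (densityModel (Set.Ioo a b) t ζ D)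
          MeasurableSpace.pi (borel _) phat ∧
        ∀ x, sobolevENorm (Set.Ioo a b) t (phat x).1 = ENNReal.ofReal D) ∧
    -- the estimators based on the simulated data
    (∀ (m : ℕ) (Θ : Set (EuclideanSpace ℝ (Fin m))), Θ.Nonempty → IsCompact Θ →
      ∀ (V : Type*) [MeasurableSpace V] (ρ : V → Θ → Set.Ioo a b),
      (∀ θ, Measurable fun v => ρ v θ) →
      ∀ k : ℕ, 1 ≤ k →
      (∀ (θ : Θ) (v : Fin k → V), ∃! p : densityModel (Set.Ioo a b) t ζ D,
        simLogLik ρ θ p.1 v = ⨆ q : densityModel (Set.Ioo a b) t ζ D, simLogLik ρ θ q.1 v) ∧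
      ∀ ptilde : Θ → (Fin k → V) → densityModel (Set.Ioo a b) t ζ D,
        (∀ θ v, simLogLik ρ θ (ptilde θ v).1 v =
          ⨆ q : densityModel (Set.Ioo a b) t ζ D, simLogLik ρ θ q.1 v) →
        (∀ θ, @Measurable (Fin k → V) (densityModel (Set.Ioo a b) t ζ D)
          MeasurableSpace.pi (borel _) (ptilde θ)) ∧
        (∀ θ v, sobolevENorm (Set.Ioo a b) t (ptilde θ v).1 = ENNReal.ofReal D) ∧
        ((∀ v, Continuous (ρ v)) → ∀ v, Continuous fun θ => ptilde θ v)) := by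
  -- part (a) is the case of a single parameter value, with `ρ` the identity
  refine ⟨fun n hn => ?_, fun m Θ _ _ V _ ρ hρ k hk =>
    mainTheorem5_general hab ht hζ hD.le hζb hbD.le hρ hk⟩
  obtain ⟨hex, hprop⟩ := mainTheorem5_general (T := Unit) (ρ := fun v _ => v) hab ht hζ hD.le
    hζb hbD.le (fun _ => measurable_id) hn
  refine ⟨hex (), fun phat h => ?_⟩
  obtain ⟨hmeas, hnorm, -⟩ := hprop (fun _ => phat) fun _ => h
  exact ⟨hmeas (), hnorm ()⟩
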